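/- **Channel.** Let $P>0$, $\sigma_w>0$. Alice sends $u(k)\in\mathbb R$, Bob receives $y(k)=u(k)+w(k)$, $k\ge 1$, where $w$ is white Gaussian noise with mean $0$ and variance $\sigma_w^2$, and Bob returns over a noiseless feedback link a signal $\hat y(k)$ which is a function of $y(1),\dots,y(k)$. An eavesdropper observes $z(k)=u(k)+v(k)$, $\tilde z(k)=y(k)+\tilde v(k)$ and $\hat z(k)=\hat y(k)+\hat v(k)$. The noise triple $(v,\tilde v,\hat v)$ is independent of $w$; its three components may be dependent on one another. They have positive variances that are bounded in $k$; the law of $(v(k),\tilde v(k),\hat v(k))_{k\le n}$ has a density for every $n$; and the triple has finite memory: for some $d$, the conditional law of the triple at time $k>d$ given its whole past is its conditional law given its values at the times $k-d,\dots,k-1$. **Codes and capacities.** A code of rate $R\ge 0$ and block length $n$ has a message uniformly distributed on $\lceil 2^{nR}\rceil$ values and independent of all the noises. The input $u(k)$ is a measurable function of the message and of $\hat y(1),\dots,\hat y(k-1)$, the feedback functions are measurable, and Bob decodes by a measurable function of $y(1),\dots,y(n)$. A sequence of codes ($n=1,2,\dots$) is reliable if its average error probability tends to $0$, and secure if $\frac1n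 I(\text{message};z_1^n,\tilde z_1^n,\hat z_1^n)\to 0$. Its power is $p_n=\frac1n\sum_{k=1}^n\mathbb E[u(k)^2]$. The feedback capacity $C_{fb}$ is the supremum of the rates of the reliable sequences that satisfy the power constraint, and the secrecy capacity $C_{sc}$ is the supremum of the rates of those that are moreover secure. The power constraint may be read either as the long-run constraint $\limsup_n p_n\le P$ or as the block constraint $p_n\le P$ for all $n$. **Proposed scheme (channel-output-based, initialized).** Given real $A_s,B_s,C_s,A_u,B_u,C_u$ and a message point $x$, let $\hat y=y$, $u(1)=A_u^2x$, $\hat x_u(2)=y(1)$, $x_s(2)=0$ and, for $k\ge2$, $$u(k)=C_u\big(A_u^kx-\hat x_u(k)\big)-C_sx_s(k),\quad \hat x_u(k+1)=A_u\hat x_u(k)+B_uy(k),\quad x_s(k+1)=A_sx_s(k)+B_sy(k).$$ Bob's estimate of $x$ is $\hat x(k)=A_u^{-k-1}\hat x_u(k+1)$, $k\ge 1$. The message points of a code with $M$ messages are the middle points of the $M$ equal subintervals of $[-\frac12,\frac12]$, and Bob decodes to the message whose subinterval contains, or is closest to, $\hat x(n)$. **Claim.** Let $A_u=\sqrt{\frac{P+\sigma_w^2}{\sigma_w^2}}$,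 $B_u=-\frac{\sqrt{A_u^2-1}}{A_u}$, $C_u=-\sqrt{A_u^2-1}$, $A_s=B_s=C_s=0$, and $C=\frac12\log_2\big(1+\frac P{\sigma_w^2}\big)$. 1. The scheme is the original Schalkwijk–Kailath scheme, up to scaling of the message point by $A_u$: for all outputs $y$ and all message points $x$, its inputs $u$ and its scaled estimates $\xi(k)=A_u\hat x(k)$ are those of the Schalkwijk–Kailath scheme with message point $x'=A_ux$, which is given by $u(1)=A_ux'$, $\xi(1)=A_u^{-1}y(1)$ and, for $k\ge2$, $$u(k)=\sqrt{A_u^2-1}\,A_u^{k-1}\big(\xi(k-1)-x'\big),\qquad \xi(k)=\xi(k-1)-A_u^{-k-1}\sqrt{A_u^2-1}\,y(k).$$ 2. For every rate $0\le R<C$, the codes of rate $R$ given by this scheme are reliable, secure, and satisfy the long-run power constraint $\limsup_n p_n\le P$. 3. $C_{sc}=C_{fb}=C$, under either reading of the power constraint. -/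

import Mathlib

open MeasureTheory ProbabilityTheory Filter Topology
open scoped ENNReal NNReal Matrix

namespace FeedbackWiretap

noncomputable section

/-! Time is indexed from zero: index `i` stands for channel use number `i + 1`. -/

/-- The number of messages of a code of rate `R` bits per channel use and block length `n`. -/
def numMessages (R : ℝ) (n : ℕ) : ℕ := ⌈(2 : ℝ) ^ ((n : ℝ) * R)⌉₊

theorem numMessages_pos (R : ℝ) (n : ℕ) : 0 < numMessages R n :=
  Nat.ceil_pos.mpr (Real.rpow_pos_of_pos two_pos _)

/-- A feedback code with block length `n` and `M` messages. At time `i` Alice sends a function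
`enc i` of the message and of the feedback signals received strictly before time `i`; then Bob
sends back a function `fb i` of all the channel outputs up to and including time `i`. After `n`
channel uses Bob applies `dec`. -/
structure Code (n M : ℕ) where
  enc : (i : ℕ) → Fin M → (Fin i → ℝ) → ℝ
  fb : (i : ℕ) → (Fin (i + 1) → ℝ) → ℝ
  dec : (Fin n → ℝ) → Fin M

namespace Code

/-- All the maps of the code are measurable. -/
def IsMeasurable {n M : ℕ} (c : Code n M) : Prop :=
  (∀ i m, Measurable (c.enc i m)) ∧ (∀ i, Measurable (c.fb i)) ∧ Measurable c.dec

/-- Bob's channel output `y i = u i + w i` when the message is `m` and the forward noise is `w`. -/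
def output {n M : ℕ} (c : Code n M) (m : Fin M) (w : ℕ → ℝ) (i : ℕ) : ℝ :=
  c.enc i m (fun j : Fin i => c.fb j (fun l : Fin (j + 1) => output c m w l)) + w i
termination_by i
decreasing_by omega

/-- The feedback signal at time `i`. -/
def feedback {n M : ℕ} (c : Code n M) (m : Fin M) (w : ℕ → ℝ) (i : ℕ) : ℝ :=
  c.fb i (fun l : Fin (i + 1) => c.output m w l)

/-- The channel input `u i`. -/
def input {n M : ℕ} (c : Code n M) (m : Fin M) (w : ℕ → ℝ) (i : ℕ) : ℝ :=
  c.enc i m (fun j : Fin i => c.feedback m w j)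

/-- The observations of the eavesdropper: the channel input, the channel output and the feedback
signal at the times `0, …, n - 1`, with additive noises `v`, `vt` and `vh`, respectively. -/
def eveObs {n M : ℕ} (c : Code n M) (m : Fin M) (w v vt vh : ℕ → ℝ) : Fin n → ℝ × ℝ × ℝ :=
  fun i => (c.input m w i + v i, c.output m w i + vt i, c.feedback m w i + vh i)

/-- The message is uniform and independent of the noises. -/
def jointMeasure {Ω : Type*} [MeasurableSpace Ω] (μ : Measure Ω) (M : ℕ) : Measure (Fin M × Ω) :=
  (uniformOn (Set.univ : Set (Fin M))).prod μ

/-- The average error probability. -/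
def errorProb {Ω : Type*} [MeasurableSpace Ω] (μ : Measure Ω) (w : ℕ → Ω → ℝ) {n M : ℕ}
    (c : Code n M) : ℝ≥0∞ :=
  (∑ m : Fin M, μ {ω | c.dec (fun i : Fin n => c.output m (fun k => w k ω) i) ≠ m}) / M

/-- The average transmit power `(1/n) ∑ E[u(i)²]` of the code. -/
def power {Ω : Type*} [MeasurableSpace Ω] (μ : Measure Ω) (w : ℕ → Ω → ℝ) {n M : ℕ}
    (c : Code n M) : ℝ≥0∞ :=
  (∑ i ∈ Finset.range n,
    ∫⁻ p, ENNReal.ofReal ((c.input p.1 (fun k => w k p.2) i) ^ 2) ∂(jointMeasure μ M)) / n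

end Code

/-- Mutual information in bits: the divergence of the joint law from the product of the
marginal laws. -/
def mutualInfo {Ω α β : Type*} [MeasurableSpace Ω] [MeasurableSpace α] [MeasurableSpace β]
    (ν : Measure Ω) (X : Ω → α) (Y : Ω → β) : ℝ≥0∞ :=
  InformationTheory.klDiv (ν.map (fun ω => (X ω, Y ω))) ((ν.map X).prod (ν.map Y)) /
    ENNReal.ofReal (Real.log 2)

/-- The information that the eavesdropper obtains about the message. -/
def Code.leakage {Ω : Type*} [MeasurableSpace Ω] (μ : Measure Ω) (w v vt vh : ℕ → Ω → ℝ)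
    {n M : ℕ} (c : Code n M) : ℝ≥0∞ :=
  mutualInfo (Code.jointMeasure μ M) (fun p : Fin M × Ω => p.1)
    (fun p : Fin M × Ω => c.eveObs p.1 (fun k => w k p.2) (fun k => v k p.2)
      (fun k => vt k p.2) (fun k => vh k p.2))

/-- The process `X` has memory at most `d`: for `k ≥ d`, the conditional law of `X k` given the
whole past `X 0, …, X (k - 1)` is its conditional law given `X (k - d), …, X (k - 1)`. -/
def HasFiniteMemory {Ω S : Type*} [MeasurableSpace Ω] [MeasurableSpace S] [StandardBorelSpace S]
    [Nonempty S] (μ : Measure Ω) [IsProbabilityMeasure μ] (X : ℕ → Ω → S) (d : ℕ) : Prop :=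
  ∀ k, d ≤ k → ∀ᵐ ω ∂μ,
    condDistrib (X k) (fun ω' (j : Fin k) => X j ω') μ (fun j => X j ω) =
      condDistrib (X k) (fun ω' (j : Fin d) => X (k - d + j) ω') μ (fun j => X (k - d + j) ω)

/-- The noises of the wiretap channel: the forward noise `w` is white Gaussian with mean `0` and
variance `σ ^ 2`; the triple of the noises `v`, `vt`, `vh` of the eavesdropper, which may depend
on one another, is independent of `w`, has finite memory, joint densities, and variances that are
positive and bounded. -/
structure IsAWGNWiretap {Ω : Type*} [MeasurableSpace Ω] (μ : Measure Ω) [IsProbabilityMeasure μ]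
    (σ : ℝ≥0) (w v vt vh : ℕ → Ω → ℝ) : Prop where
  measurable_w : ∀ k, Measurable (w k)
  measurable_v : ∀ k, Measurable (v k)
  measurable_vt : ∀ k, Measurable (vt k)
  measurable_vh : ∀ k, Measurable (vh k)
  gaussian_w : ∀ k, μ.map (w k) = gaussianReal 0 (σ ^ 2)
  white_w : iIndepFun w μ
  indep : IndepFun (fun ω k => w k ω) (fun ω k => (v k ω, vt k ω, vh k ω)) μ
  finiteMemory : ∃ d, HasFiniteMemory μ (fun k ω => (v k ω, vt k ω, vh k ω)) d
  density : ∀ n : ℕ,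
    μ.map (fun ω (j : Fin n) => (v j ω, vt j ω, vh j ω)) ≪ (volume : Measure (Fin n → ℝ × ℝ × ℝ))
  memLp_noise : ∀ k, MemLp (v k) 2 μ ∧ MemLp (vt k) 2 μ ∧ MemLp (vh k) 2 μ
  variance_pos : ∀ k, 0 < variance (v k) μ ∧ 0 < variance (vt k) μ ∧ 0 < variance (vh k) μ
  variance_bdd : ∃ K : ℝ, ∀ k,
    variance (v k) μ ≤ K ∧ variance (vt k) μ ≤ K ∧ variance (vh k) μ ≤ K

/-- A sequence of codes of rate `R`, one for each block length. -/
abbrev CodeSeq (R : ℝ) : Type := (n : ℕ) → Code n (numMessages R n)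

/-- Long-run average power constraint. -/
def LongRunPower {Ω : Type*} [MeasurableSpace Ω] (μ : Measure Ω) (w : ℕ → Ω → ℝ) (P : ℝ)
    {R : ℝ} (c : CodeSeq R) : Prop :=
  limsup (fun n => (c n).power μ w) atTop ≤ ENNReal.ofReal P

/-- Average power constraint on each block. -/
def BlockPower {Ω : Type*} [MeasurableSpace Ω] (μ : Measure Ω) (w : ℕ → Ω → ℝ) (P : ℝ)
    {R : ℝ} (c : CodeSeq R) : Prop :=
  ∀ n, (c n).power μ w ≤ ENNReal.ofReal P

/-- The error probability tends to zero. -/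
def Reliable {Ω : Type*} [MeasurableSpace Ω] (μ : Measure Ω) (w : ℕ → Ω → ℝ)
    {R : ℝ} (c : CodeSeq R) : Prop :=
  (∀ n, (c n).IsMeasurable) ∧ Tendsto (fun n => (c n).errorProb μ w) atTop (𝓝 0)

/-- The normalized information leakage tends to zero. -/
def Secure {Ω : Type*} [MeasurableSpace Ω] (μ : Measure Ω) (w v vt vh : ℕ → Ω → ℝ)
    {R : ℝ} (c : CodeSeq R) : Prop :=
  Tendsto (fun n : ℕ => (c n).leakage μ w v vt vh / (n : ℝ≥0∞)) atTop (𝓝 0)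

/-- The rates that are achievable with feedback under the power constraint `Pow`. -/
def feedbackRates {Ω : Type*} [MeasurableSpace Ω] (μ : Measure Ω) (w : ℕ → Ω → ℝ)
    (Pow : ∀ {R : ℝ}, CodeSeq R → Prop) : Set ℝ :=
  {R | 0 ≤ R ∧ ∃ c : CodeSeq R, Reliable μ w c ∧ Pow c}

/-- The rates that are achievable with feedback and with secrecy under the power constraint
`Pow`. -/
def secrecyRates {Ω : Type*} [MeasurableSpace Ω] (μ : Measure Ω) (w v vt vh : ℕ → Ω → ℝ)
    (Pow : ∀ {R : ℝ}, CodeSeq R → Prop) : Set ℝ :=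
  {R | 0 ≤ R ∧ ∃ c : CodeSeq R, Reliable μ w c ∧ Pow c ∧ Secure μ w v vt vh c}

/-! ### The channel-output-based coding scheme -/

/-- The matrices of the coding scheme, with `p` stable and `m` unstable states. -/
structure KParams (p m : ℕ) where
  As : Matrix (Fin p) (Fin p) ℝ
  Bs : Fin p → ℝ
  Cs : Fin p → ℝ
  Au : Matrix (Fin m) (Fin m) ℝ
  Bu : Fin m → ℝ
  Cu : Fin m → ℝ

namespace KParams

/-- The parameters with one stable and one unstable state. -/
def scalar (As Bs Cs Au Bu Cu : ℝ) : KParams 1 1 where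
  As := !![As]
  Bs := ![Bs]
  Cs := ![Cs]
  Au := !![Au]
  Bu := ![Bu]
  Cu := ![Cu]

/-- The state `x_s` for the outputs `y`, in channel use number `m + 1 + j`; it is initialized by
zero in channel use number `m + 1`. -/
def stableState {p m : ℕ} (K : KParams p m) (y : ℕ → ℝ) : ℕ → Fin p → ℝ
  | 0 => 0
  | j + 1 => K.As *ᵥ K.stableState y j + y (m + j) • K.Bs

/-- The state `x̂_u` for the outputs `y`, in channel use number `m + 1 + j`; it is initialized by
the first `m` outputs in channel use number `m + 1`. -/
def unstableState {p m : ℕ} (K : KParams p m) (y : ℕ → ℝ) : ℕ → Fin m → ℝ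
  | 0 => fun i => y i
  | j + 1 => K.Au *ᵥ K.unstableState y j + y (m + j) • K.Bu

/-- The channel input at time `i` for the message point `x`: the first `m` inputs are the
coordinates of `A_u ^ (m + 1) x`; afterwards, in channel use number `k = i + 1`, the input is
`C_u (A_u ^ k x - x̂_u(k)) - C_s x_s(k)`. -/
def input {p m : ℕ} (K : KParams p m) (x : Fin m → ℝ) (y : ℕ → ℝ) (i : ℕ) : ℝ :=
  if h : i < m then ((K.Au ^ (m + 1)) *ᵥ x) ⟨i, h⟩
  else K.Cu ⬝ᵥ ((K.Au ^ (i + 1)) *ᵥ x - K.unstableState y (i - m)) -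
    K.Cs ⬝ᵥ K.stableState y (i - m)

/-- The estimate `A_u ^ (-k - 1) x̂_u(k + 1)` of the message point after `k ≥ m` channel uses. -/
def estimate {p m : ℕ} (K : KParams p m) (y : ℕ → ℝ) (k : ℕ) : Fin m → ℝ :=
  (K.Au⁻¹ ^ (k + 1)) *ᵥ K.unstableState y (k - m)

end KParams

/-- Extension of a finite history by zeros. -/
def extendZero {n : ℕ} (h : Fin n → ℝ) (j : ℕ) : ℝ := if hj : j < n then h ⟨j, hj⟩ else 0

/-- The middle point of the subinterval number `j` when `[-1/2, 1/2]` is divided into `M`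
subintervals of the same length. -/
def messagePoint (M : ℕ) (j : Fin M) : ℝ := -1 / 2 + ((j : ℝ) + 1 / 2) / M

/-- The index of the subinterval that contains `t`, or is closest to `t`. -/
def nearestMessage {M : ℕ} (hM : 0 < M) (t : ℝ) : Fin M :=
  ⟨min ⌊(t + 1 / 2) * M⌋₊ (M - 1), by omega⟩

/-- The code of block length `n` with `M` messages that is given by the coding scheme with one
unstable state. The feedback signal is the channel output itself. -/
def KParams.code {p : ℕ} (K : KParams p 1) (n : ℕ) {M : ℕ} (hM : 0 < M) : Code n M where
  enc i j h := K.input (fun _ => messagePoint M j) (extendZero h) i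
  fb i h := h (Fin.last i)
  dec y := nearestMessage hM (K.estimate (extendZero y) n 0)

/-- The codes of rate `R` that are given by the coding scheme with one unstable state. -/
def KParams.codeSeq {p : ℕ} (K : KParams p 1) (R : ℝ) : CodeSeq R :=
  fun n => K.code n (numMessages_pos R n)

/-! ### The original scheme of Schalkwijk and Kailath -/

/-- The estimate of the message point after channel use number `i + 1`. -/
def skEstimate (a : ℝ) (y : ℕ → ℝ) : ℕ → ℝ
  | 0 => a⁻¹ * y 0
  | i + 1 => skEstimate a y i - a⁻¹ ^ (i + 3) * √(a ^ 2 - 1) * y (i + 1)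

/-- The channel input in channel use number `i + 1` for the message point `x`. -/
def skInput (a x : ℝ) (y : ℕ → ℝ) : ℕ → ℝ
  | 0 => a * x
  | i + 1 => √(a ^ 2 - 1) * a ^ (i + 1) * (skEstimate a y i - x)

end

end FeedbackWiretap

namespace FeedbackWiretap

/-! ### The scalar scheme -/

/-! Write a for the gain A_u and e(k) for the estimation error x̂_u(k+1) - a^(k+1) x of the state.
The feedback loop closes to e(k+1) = a⁻¹ e(k) - (√(a² - 1)/a) w(k+1) with e(1) = w(1). Thus the
error is driven by the forward noise alone and has variance σ² at all times. Reliability, power and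
secrecy all follow from this (`sk_code_state`, `sk_code_input`). The estimate is x plus a^(-n-1)
times a variable of variance σ², so by Chebyshev the messages are resolved whenever 2^R < a, that
is, R < C. Every input after the first has power (a² - 1)σ² = P.

Secrecy: the message occurs only in the first input, as the bounded term a² x. The eavesdropper's
view is therefore a function of w and of her own noises, with the first noise triple translated by a
vector of bounded norm. Revealing w costs nothing, since it is independent of these noises. Finite
memory makes all but the first d + 1 noise triples useless (`mutualInfo_firstShift_le`). What
remains is a bounded translation of one fixed random vector with a density, which carries at most
C_ε + ε log M of information for every ε > 0 (`exists_mutualInfo_shift_le`). Since log M = O(n), the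
leakage rate vanishes.

Converse: weighting by the reciprocal likelihood ratio exp(-I) gives the outputs a law Q that does
not depend on the message (`exists_output_reference`), so the decoding regions have total Q-mass
one. The inequality 1 + x ≤ exp x then bounds the success probability times log M by the mean of I
plus one. That mean is explicit, because the current input is uncorrelated with the current noise;
for reference variance P + σ² it yields R ≤ C.

Under the block constraint the first input needs room, which is made by running the scheme at a
slightly smaller power. -/

theorem of_scalar_pow (a : ℝ) (k : ℕ) : (!![a] : Matrix (Fin 1) (Fin 1) ℝ) ^ k = !![a ^ k] := by
  induction k with
  | zero => ext i j; fin_cases i; fin_cases j; simp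
  | succ k ih => rw [pow_succ, ih]; ext i j; fin_cases i; fin_cases j; simp [pow_succ]

theorem of_scalar_inv (a : ℝ) : (!![a] : Matrix (Fin 1) (Fin 1) ℝ)⁻¹ = !![a⁻¹] := by
  ext i j
  fin_cases i; fin_cases j
  simp

theorem scalar_unstableState_zero (a b c : ℝ) (y : ℕ → ℝ) :
    (KParams.scalar 0 0 0 a b c).unstableState y 0 0 = y 0 := rfl

theorem scalar_unstableState_succ (a b c : ℝ) (y : ℕ → ℝ) (j : ℕ) :
    (KParams.scalar 0 0 0 a b c).unstableState y (j + 1) 0 =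
      a * (KParams.scalar 0 0 0 a b c).unstableState y j 0 + y (j + 1) * b := by
  simp [KParams.unstableState, KParams.scalar, dotProduct, add_comm]

theorem scalar_input_zero (a b c x : ℝ) (y : ℕ → ℝ) :
    (KParams.scalar 0 0 0 a b c).input (fun _ => x) y 0 = a ^ 2 * x := by
  simp [KParams.input, KParams.scalar, of_scalar_pow, Matrix.mulVec, dotProduct]

theorem scalar_input_succ (a b c x : ℝ) (y : ℕ → ℝ) (i : ℕ) :
    (KParams.scalar 0 0 0 a b c).input (fun _ => x) y (i + 1) =
      c * (a ^ (i + 2) * x - (KParams.scalar 0 0 0 a b c).unstableState y i 0) := by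
  simp [KParams.input, KParams.scalar, of_scalar_pow, dotProduct]

theorem scalar_estimate (a b c : ℝ) (y : ℕ → ℝ) (k : ℕ) :
    (KParams.scalar 0 0 0 a b c).estimate y k 0 =
      a⁻¹ ^ (k + 1) * (KParams.scalar 0 0 0 a b c).unstableState y (k - 1) 0 := by
  simp only [KParams.estimate]
  simp only [KParams.scalar, of_scalar_inv, of_scalar_pow]
  simp [Matrix.mulVec, dotProduct]

theorem scalar_estimate_eq_skEstimate {a : ℝ} (ha : a ≠ 0) (c : ℝ) (y : ℕ → ℝ) (i : ℕ) :
    a * (KParams.scalar 0 0 0 a (-(√(a ^ 2 - 1) / a)) c).estimate y (i + 1) 0 =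
      skEstimate a y i := by
  induction i with
  | zero =>
    rw [scalar_estimate]
    simp only [zero_add, Nat.sub_self, scalar_unstableState_zero, skEstimate, inv_pow]
    field_simp
  | succ i ih =>
    rw [skEstimate, ← ih, scalar_estimate, scalar_estimate]
    simp only [Nat.add_sub_cancel, scalar_unstableState_succ, inv_pow]
    field_simp
    ring

theorem scalar_input_eq_skInput {a : ℝ} (ha : a ≠ 0) (x : ℝ) (y : ℕ → ℝ) (i : ℕ) :
    (KParams.scalar 0 0 0 a (-(√(a ^ 2 - 1) / a)) (-√(a ^ 2 - 1))).input (fun _ => x) y i =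
      skInput a (a * x) y i := by
  cases i with
  | zero => rw [scalar_input_zero, skInput]; ring
  | succ i =>
    rw [scalar_input_succ, skInput, ← scalar_estimate_eq_skEstimate ha (-√(a ^ 2 - 1)) y i,
      scalar_estimate]
    simp only [Nat.add_sub_cancel, inv_pow]
    field_simp
    ring

/-- Causality of the state: it allows the encoder's zero-extended history to be replaced by the full
output sequence. -/
theorem unstableState_congr {p : ℕ} (K : KParams p 1) {y y' : ℕ → ℝ} {i : ℕ}
    (h : ∀ j ≤ i, y j = y' j) : K.unstableState y i = K.unstableState y' i := by
  induction i with
  | zero => funext l; fin_cases l; simpa [KParams.unstableState] using h 0 le_rfl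
  | succ i ih =>
    rw [KParams.unstableState, KParams.unstableState, ih fun j hj => h j (by omega),
      h (1 + i) (by omega)]

/-- The parameters of the scheme with `A_u = a`, `B_u = -√(a² - 1) / a`, `C_u = -√(a² - 1)`. -/
noncomputable def skParams (a : ℝ) : KParams 1 1 :=
  KParams.scalar 0 0 0 a (-(√(a ^ 2 - 1) / a)) (-√(a ^ 2 - 1))

/-- The error `x̂_u - A_u ^ k x` of the unstable state, as a function of the forward noise. -/
noncomputable def stateError (a : ℝ) (w : ℕ → ℝ) : ℕ → ℝ
  | 0 => w 0
  | i + 1 => a⁻¹ * stateError a w i - √(a ^ 2 - 1) / a * w (i + 1)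

/-- The part of the channel input of the scheme that does not depend on the message. -/
noncomputable def noiseInput (a : ℝ) (w : ℕ → ℝ) : ℕ → ℝ
  | 0 => 0
  | i + 1 => √(a ^ 2 - 1) * stateError a w i

theorem code_feedback {p n M : ℕ} (K : KParams p 1) (hM : 0 < M) (m : Fin M) (w : ℕ → ℝ) (i : ℕ) :
    (K.code n hM).feedback m w i = (K.code n hM).output m w i := rfl

theorem Code.output_eq {n M : ℕ} (c : Code n M) (m : Fin M) (w : ℕ → ℝ) (i : ℕ) :
    c.output m w i = c.input m w i + w i := by
  rw [Code.output, Code.input]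
  rfl

theorem extendZero_apply {n : ℕ} (f : ℕ → ℝ) {j : ℕ} (hj : j < n) :
    extendZero (fun i : Fin n => f i) j = f j := by
  simp [extendZero, hj]

theorem skParams_input_succ (a x : ℝ) (y : ℕ → ℝ) (i : ℕ) :
    (skParams a).input (fun _ => x) y (i + 1) =
      √(a ^ 2 - 1) * ((skParams a).unstableState y i 0 - a ^ (i + 2) * x) := by
  rw [skParams, scalar_input_succ]
  ring

section

variable {a : ℝ} {n M : ℕ} (hM : 0 < M) (m : Fin M) (w : ℕ → ℝ)

theorem code_input {p : ℕ} (K : KParams p 1) (i : ℕ) :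
    (K.code n hM).input m w i = K.input (fun _ => messagePoint M m)
      (extendZero fun j : Fin i => (K.code n hM).output m w j) i := by
  rw [Code.input]
  rfl

theorem sk_code_input_zero :
    ((skParams a).code n hM).input m w 0 = a ^ 2 * messagePoint M m := by
  rw [code_input, skParams, scalar_input_zero]

theorem sk_code_input_succ (i : ℕ) :
    ((skParams a).code n hM).input m w (i + 1) = √(a ^ 2 - 1) *
      ((skParams a).unstableState (((skParams a).code n hM).output m w) i 0 -
        a ^ (i + 2) * messagePoint M m) := by
  rw [code_input, skParams_input_succ,
    unstableState_congr (y' := ((skParams a).code n hM).output m w)]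
  intro j hj
  exact extendZero_apply (n := i + 1) (((skParams a).code n hM).output m w) (by omega)

variable (ha : 1 < a)
include ha

/-- The feedback moves the unstable eigenvalue a to a - (a² - 1)/a = a⁻¹, and the terms in the
message point cancel. The initialization by y(1) = a² x + w(1) makes the initial error pure noise.
-/
theorem sk_code_state (i : ℕ) :
    (skParams a).unstableState (((skParams a).code n hM).output m w) i 0 =
      stateError a w i + a ^ (i + 2) * messagePoint M m := by
  have h0 : a ≠ 0 := by positivity
  have hs : √(a ^ 2 - 1) ^ 2 = a ^ 2 - 1 := Real.sq_sqrt (by nlinarith)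
  induction i with
  | zero =>
    change ((skParams a).code n hM).output m w 0 = _
    rw [Code.output_eq, sk_code_input_zero, stateError]
    ring
  | succ i ih =>
    have h1 := sk_code_input_succ (a := a) (n := n) hM m w i
    rw [ih] at h1
    conv_lhs => rw [skParams, scalar_unstableState_succ, ← skParams]
    rw [ih, Code.output_eq, h1, stateError]
    field_simp
    linear_combination (-stateError a w i) * hs

/-- The structural fact behind both the power bound and secrecy: after the first channel use the
inputs carry no trace of the message. -/
theorem sk_code_input (i : ℕ) :
    ((skParams a).code n hM).input m w i =
      noiseInput a w i + if i = 0 then a ^ 2 * messagePoint M m else 0 := by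
  cases i with
  | zero => simp [noiseInput, sk_code_input_zero]
  | succ i => simp [noiseInput, sk_code_input_succ, sk_code_state hM m w ha]

theorem sk_code_estimate (hn : 0 < n) :
    (skParams a).estimate (extendZero fun i : Fin n => ((skParams a).code n hM).output m w i) n 0 =
      messagePoint M m + a⁻¹ ^ (n + 1) * stateError a w (n - 1) := by
  have h0 : a ≠ 0 := by positivity
  conv_lhs => rw [skParams, scalar_estimate, ← skParams]
  rw [unstableState_congr (y' := ((skParams a).code n hM).output m w), sk_code_state hM m w ha,
    show n - 1 + 2 = n + 1 by omega]
  · rw [inv_pow]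
    field_simp
    ring
  · intro j hj
    exact extendZero_apply (n := n) (((skParams a).code n hM).output m w) (by omega)

end

theorem nearestMessage_messagePoint_add {M : ℕ} (hM : 0 < M) (m : Fin M) {t : ℝ}
    (ht : |t| * (2 * M) < 1) : nearestMessage hM (messagePoint M m + t) = m := by
  have hM' : (0 : ℝ) < M := by exact_mod_cast hM
  have h1 : (messagePoint M m + t + 1 / 2) * M = m + 1 / 2 + t * M := by
    rw [messagePoint]; field_simp; ring
  obtain ⟨h2, h3⟩ := abs_lt.1 (show |t * M| < 1 / 2 by rw [abs_mul, abs_of_pos hM']; linarith)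
  have h4 : ⌊(messagePoint M m + t + 1 / 2) * M⌋₊ = m := by
    rw [h1, Nat.floor_eq_iff (by linarith [(Nat.cast_nonneg (m : ℕ) : (0 : ℝ) ≤ (m : ℕ))])]
    constructor <;> linarith
  ext
  simp only [nearestMessage, h4]
  have := m.2
  omega

theorem abs_messagePoint_le {M : ℕ} (hM : 0 < M) (m : Fin M) : |messagePoint M m| ≤ 1 / 2 := by
  have hM' : (0 : ℝ) < M := by exact_mod_cast hM
  have hm : ((m : ℕ) : ℝ) + 1 ≤ M := by exact_mod_cast m.2
  have hm0 : (0 : ℝ) ≤ (m : ℕ) := Nat.cast_nonneg _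
  rw [messagePoint, abs_le]
  constructor
  · have : 0 ≤ (((m : ℕ) : ℝ) + 1 / 2) / M := by positivity
    linarith
  · have : (((m : ℕ) : ℝ) + 1 / 2) / M ≤ 1 := by rw [div_le_one hM']; linarith
    linarith

/-! ### The uniform message and the forward noise -/

theorem uniformOn_univ_fin (M : ℕ) :
    uniformOn (Set.univ : Set (Fin M)) = (M : ℝ≥0∞)⁻¹ • Measure.count := by
  simp [uniformOn, ProbabilityTheory.cond]

instance (M : ℕ) [NeZero M] : IsProbabilityMeasure (uniformOn (Set.univ : Set (Fin M))) :=
  isProbabilityMeasure_uniformOn Set.finite_univ Set.univ_nonempty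

instance (M : ℕ) : SFinite (uniformOn (Set.univ : Set (Fin M))) := by
  rw [uniformOn_univ_fin]; infer_instance

theorem lintegral_uniformOn_fin {M : ℕ} (f : Fin M → ℝ≥0∞) :
    ∫⁻ m, f m ∂(uniformOn (Set.univ : Set (Fin M))) = (∑ m, f m) / M := by
  rw [uniformOn_univ_fin, lintegral_smul_measure, lintegral_count, tsum_fintype, smul_eq_mul,
    ENNReal.div_eq_inv_mul]

section

variable {Ω : Type*} [MeasurableSpace Ω] {μ : Measure Ω}

instance [IsProbabilityMeasure μ] (M : ℕ) [NeZero M] :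
    IsProbabilityMeasure (Code.jointMeasure μ M) := by
  rw [Code.jointMeasure]; infer_instance

theorem lintegral_jointMeasure [SFinite μ] {M : ℕ} {f : Fin M × Ω → ℝ≥0∞} (hf : Measurable f) :
    ∫⁻ p, f p ∂(Code.jointMeasure μ M) = (∑ m, ∫⁻ ω, f (m, ω) ∂μ) / M := by
  rw [Code.jointMeasure, lintegral_prod _ hf.aemeasurable, lintegral_uniformOn_fin]

/-- `w` is white Gaussian noise with mean `0` and variance `σ ^ 2`. -/
structure IsWhiteGaussian (μ : Measure Ω) (σ : ℝ≥0) (w : ℕ → Ω → ℝ) : Prop where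
  measurable : ∀ k, Measurable (w k)
  gaussian : ∀ k, μ.map (w k) = gaussianReal 0 (σ ^ 2)
  white : iIndepFun w μ

theorem IsAWGNWiretap.isWhiteGaussian [IsProbabilityMeasure μ] {σ : ℝ≥0} {w v vt vh : ℕ → Ω → ℝ}
    (h : IsAWGNWiretap μ σ w v vt vh) : IsWhiteGaussian μ σ w :=
  ⟨h.measurable_w, h.gaussian_w, h.white_w⟩

namespace IsWhiteGaussian

variable {σ : ℝ≥0} {w : ℕ → Ω → ℝ} (hw : IsWhiteGaussian μ σ w)
include hw

theorem memLp (k : ℕ) : MemLp (w k) 2 μ := by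
  have h := memLp_id_gaussianReal (μ := 0) (v := σ ^ 2) 2
  rw [← hw.gaussian k, memLp_map_measure_iff aestronglyMeasurable_id
    (hw.measurable k).aemeasurable] at h
  exact h

theorem integral_eq (k : ℕ) : ∫ ω, w k ω ∂μ = 0 := by
  rw [← integral_id_gaussianReal (μ := 0) (v := σ ^ 2), ← hw.gaussian k,
    integral_map (hw.measurable k).aemeasurable (by fun_prop)]

theorem integral_sq (k : ℕ) : ∫ ω, w k ω ^ 2 ∂μ = (σ : ℝ) ^ 2 := by
  have h1 := variance_of_integral_eq_zero (μ := gaussianReal 0 (σ ^ 2)) (X := id)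
    aemeasurable_id (by simp)
  rw [variance_id_gaussianReal, ← hw.gaussian k, integral_map (hw.measurable k).aemeasurable
    (by fun_prop)] at h1
  simpa using h1.symm

theorem integral_mul_eq_zero [IsProbabilityMeasure μ] {j k : ℕ} (hjk : j ≠ k) :
    ∫ ω, w j ω * w k ω ∂μ = 0 := by
  rw [(hw.white.indepFun hjk).integral_fun_mul_eq_mul_integral
    (hw.measurable j).aestronglyMeasurable (hw.measurable k).aestronglyMeasurable,
    hw.integral_eq, zero_mul]

end IsWhiteGaussian

/-! ### Power and reliability of the scheme -/

theorem measurable_stateError (a : ℝ) (i : ℕ) : Measurable fun w : ℕ → ℝ => stateError a w i := by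
  induction i with
  | zero => exact measurable_pi_apply 0
  | succ i ih => exact (ih.const_mul _).sub ((measurable_pi_apply (i + 1)).const_mul _)

theorem measurable_noiseInput (a : ℝ) (i : ℕ) : Measurable fun w : ℕ → ℝ => noiseInput a w i := by
  cases i with
  | zero => exact measurable_const
  | succ i => exact (measurable_stateError a i).const_mul _

section

variable [IsProbabilityMeasure μ] {σ : ℝ≥0} {w : ℕ → Ω → ℝ} (hw : IsWhiteGaussian μ σ w) (a : ℝ)
include hw

omit [IsProbabilityMeasure μ] in
theorem memLp_stateError (i : ℕ) : MemLp (fun ω => stateError a (fun k => w k ω) i) 2 μ := by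
  induction i with
  | zero => exact hw.memLp 0
  | succ i ih => exact (ih.const_mul _).sub ((hw.memLp (i + 1)).const_mul _)

/-- The error at time i is a linear combination of the noises up to time i, each uncorrelated with a
later noise. -/
theorem integral_stateError_mul {i k : ℕ} (hik : i < k) :
    ∫ ω, stateError a (fun k => w k ω) i * w k ω ∂μ = 0 := by
  induction i with
  | zero => exact hw.integral_mul_eq_zero hik.ne
  | succ i ih =>
    have h1 : Integrable (fun ω => stateError a (fun k => w k ω) i * w k ω) μ :=
      (memLp_stateError hw a i).integrable_mul (hw.memLp k)
    have h2 : Integrable (fun ω => w (i + 1) ω * w k ω) μ :=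
      (hw.memLp (i + 1)).integrable_mul (hw.memLp k)
    calc ∫ ω, stateError a (fun k => w k ω) (i + 1) * w k ω ∂μ
      _ = ∫ ω, a⁻¹ * (stateError a (fun k => w k ω) i * w k ω) -
            √(a ^ 2 - 1) / a * (w (i + 1) ω * w k ω) ∂μ := by
          congr 1; funext ω; simp only [stateError]; ring
      _ = 0 := by
          rw [integral_sub (h1.const_mul _) (h2.const_mul _), integral_const_mul,
            integral_const_mul, ih (by omega), hw.integral_mul_eq_zero hik.ne]
          simp

/-- The variance starts at its fixed point σ², because a⁻² + (a² - 1)/a² = 1. -/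
theorem integral_stateError_sq (ha : 1 < a) (i : ℕ) :
    ∫ ω, stateError a (fun k => w k ω) i ^ 2 ∂μ = (σ : ℝ) ^ 2 := by
  induction i with
  | zero => exact hw.integral_sq 0
  | succ i ih =>
    have h0 : a ≠ 0 := by positivity
    have hs : √(a ^ 2 - 1) ^ 2 = a ^ 2 - 1 := Real.sq_sqrt (by nlinarith)
    have h1 : Integrable (fun ω => stateError a (fun k => w k ω) i * w (i + 1) ω) μ :=
      (memLp_stateError hw a i).integrable_mul (hw.memLp (i + 1))
    have h2 := (hw.memLp (i + 1)).integrable_sq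
    have h3 := (memLp_stateError hw a i).integrable_sq
    calc ∫ ω, stateError a (fun k => w k ω) (i + 1) ^ 2 ∂μ
      _ = ∫ ω, a⁻¹ ^ 2 * stateError a (fun k => w k ω) i ^ 2 -
            2 * √(a ^ 2 - 1) / a ^ 2 * (stateError a (fun k => w k ω) i * w (i + 1) ω) +
            (a ^ 2 - 1) / a ^ 2 * w (i + 1) ω ^ 2 ∂μ := by
          congr 1; funext ω; simp only [stateError]; field_simp
          linear_combination w (i + 1) ω ^ 2 * hs
      _ = (σ : ℝ) ^ 2 := by
          rw [integral_add (by exact (h3.const_mul _).sub (h1.const_mul _)) (h2.const_mul _),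
            integral_sub (h3.const_mul _) (h1.const_mul _), integral_const_mul,
            integral_const_mul, integral_const_mul, ih,
            integral_stateError_mul hw a (Nat.lt_succ_self i), hw.integral_sq]
          field_simp
          ring

theorem lintegral_noiseInput_sq (ha : 1 < a) (i : ℕ) :
    ∫⁻ ω, ENNReal.ofReal (noiseInput a (fun k => w k ω) i ^ 2) ∂μ ≤
      ENNReal.ofReal ((a ^ 2 - 1) * (σ : ℝ) ^ 2) := by
  cases i with
  | zero => simp [noiseInput]
  | succ i =>
    have hs : √(a ^ 2 - 1) ^ 2 = a ^ 2 - 1 := Real.sq_sqrt (by nlinarith)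
    have h1 := (memLp_stateError hw a i).integrable_sq
    simp only [noiseInput, mul_pow, hs]
    rw [← ofReal_integral_eq_lintegral_ofReal (h1.const_mul _)
      (ae_of_all _ fun ω => mul_nonneg (by nlinarith) (sq_nonneg _)), integral_const_mul,
      integral_stateError_sq hw a ha]

/-- The term a⁴/4 bounds the square of the first input a² x, since |x| ≤ 1/2; averaged over the
block it is the only excess over the stationary power. -/
theorem sk_code_power_le (ha : 1 < a) {n M : ℕ} (hn : 0 < n) (hM : 0 < M) :
    ((skParams a).code n hM).power μ w ≤
      ENNReal.ofReal (a ^ 4 / 4 / n + (a ^ 2 - 1) * (σ : ℝ) ^ 2) := by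
  have : NeZero M := ⟨hM.ne'⟩
  have hn' : (0 : ℝ) < n := by exact_mod_cast hn
  have hP : 0 ≤ (a ^ 2 - 1) * (σ : ℝ) ^ 2 := mul_nonneg (by nlinarith) (sq_nonneg _)
  have hsum : ∑ i ∈ Finset.range n, ∫⁻ p, ENNReal.ofReal
      ((((skParams a).code n hM).input p.1 (fun k => w k p.2) i) ^ 2) ∂(Code.jointMeasure μ M) ≤
      ∑ i ∈ Finset.range n, ((if i = 0 then ENNReal.ofReal (a ^ 4 / 4) else 0) +
        ENNReal.ofReal ((a ^ 2 - 1) * (σ : ℝ) ^ 2)) := by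
    refine Finset.sum_le_sum fun i _ => ?_
    by_cases hi : i = 0
    · subst hi
      simp only [sk_code_input hM _ _ ha, noiseInput, if_true, zero_add]
      refine le_add_right ?_
      refine (lintegral_mono fun p => ENNReal.ofReal_le_ofReal (?_ : _ ≤ a ^ 4 / 4)).trans (by simp)
      have h1 := sq_le_sq' (abs_le.1 (abs_messagePoint_le hM p.1)).1
        (abs_le.1 (abs_messagePoint_le hM p.1)).2
      rw [mul_pow]
      nlinarith [sq_nonneg (a ^ 2)]
    · simp only [sk_code_input hM _ _ ha, if_neg hi, add_zero, zero_add]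
      have hmeas : Measurable fun p : Fin M × Ω =>
          ENNReal.ofReal (noiseInput a (fun k => w k p.2) i ^ 2) :=
        (((measurable_noiseInput a i).comp (measurable_pi_lambda _ fun k =>
          (hw.measurable k).comp measurable_snd)).pow_const 2).ennreal_ofReal
      rw [lintegral_jointMeasure hmeas]
      simp only [Finset.sum_const, Finset.card_univ, Fintype.card_fin, nsmul_eq_mul]
      rw [mul_div_assoc, mul_comm, ENNReal.div_mul_cancel (by simpa using hM.ne') (by simp)]
      exact lintegral_noiseInput_sq hw a ha i
  have hsum2 : ∑ i ∈ Finset.range n, ((if i = 0 then ENNReal.ofReal (a ^ 4 / 4) else 0) +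
        ENNReal.ofReal ((a ^ 2 - 1) * (σ : ℝ) ^ 2)) =
      ENNReal.ofReal (a ^ 4 / 4 + n * ((a ^ 2 - 1) * (σ : ℝ) ^ 2)) := by
    rw [Finset.sum_add_distrib, Finset.sum_ite_eq' (Finset.range n) 0, if_pos (by simpa using hn),
      Finset.sum_const, Finset.card_range, nsmul_eq_mul,
      ENNReal.ofReal_add (by positivity) (by positivity),
      ENNReal.ofReal_mul (Nat.cast_nonneg _), ENNReal.ofReal_natCast]
  rw [Code.power]
  refine (ENNReal.div_le_div_right (hsum.trans_eq hsum2) _).trans_eq ?_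
  rw [← ENNReal.ofReal_natCast n, ← ENNReal.ofReal_div_of_pos hn']
  congr 1
  field_simp

/-- Decoding fails only if the estimate is off by at least half a subinterval, 1/(2M); Chebyshev's
inequality bounds the probability of this. -/
theorem sk_code_errorProb_le (ha : 1 < a) {n M : ℕ} (hn : 0 < n) (hM : 0 < M) :
    ((skParams a).code n hM).errorProb μ w ≤
      ENNReal.ofReal (4 * M ^ 2 * (σ : ℝ) ^ 2 * a⁻¹ ^ (2 * (n + 1))) := by
  have h0 : 0 < a := by positivity
  have hM' : (0 : ℝ) < M := by exact_mod_cast hM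
  set b : ℝ := 4 * M ^ 2 * a⁻¹ ^ (2 * (n + 1)) with hb
  have hb0 : 0 ≤ b := by positivity
  have key (m : Fin M) : μ {ω | ((skParams a).code n hM).dec (fun i : Fin n =>
      ((skParams a).code n hM).output m (fun k => w k ω) i) ≠ m} ≤
      ENNReal.ofReal (4 * M ^ 2 * (σ : ℝ) ^ 2 * a⁻¹ ^ (2 * (n + 1))) := by
    have hint := (memLp_stateError hw a (n - 1)).integrable_sq
    have hsub : {ω | ((skParams a).code n hM).dec (fun i : Fin n =>
        ((skParams a).code n hM).output m (fun k => w k ω) i) ≠ m} ⊆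
        {ω | 1 ≤ ENNReal.ofReal (b * stateError a (fun k => w k ω) (n - 1) ^ 2)} := by
      intro ω hω
      by_contra hcon
      apply hω
      change nearestMessage hM _ = m
      rw [sk_code_estimate hM m _ ha hn]
      apply nearestMessage_messagePoint_add
      have h1 : b * stateError a (fun k => w k ω) (n - 1) ^ 2 < 1 := by
        simpa using hcon
      rw [← abs_of_pos (show (0 : ℝ) < 2 * M by positivity), ← abs_mul, ← sq_lt_one_iff_abs_lt_one]
      refine lt_of_eq_of_lt ?_ h1
      rw [hb]
      ring
    refine (measure_mono hsub).trans ((meas_ge_le_lintegral_div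
      (hint.aestronglyMeasurable.aemeasurable.const_mul b).ennreal_ofReal
      one_ne_zero ENNReal.one_ne_top).trans_eq ?_)
    rw [div_one, ← ofReal_integral_eq_lintegral_ofReal (hint.const_mul _)
      (ae_of_all _ fun ω => mul_nonneg hb0 (sq_nonneg _)), integral_const_mul,
      integral_stateError_sq hw a ha, hb]
    congr 1
    ring
  rw [Code.errorProb]
  refine ENNReal.div_le_of_le_mul ?_
  refine (Finset.sum_le_sum fun m _ => key m).trans_eq ?_
  simp [mul_comm]

end

/-- For R ≥ 0 the number under the ceiling is at least 1, so rounding up at most doubles it. -/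
theorem numMessages_le {R : ℝ} (hR : 0 ≤ R) (n : ℕ) :
    (numMessages R n : ℝ) ≤ 2 * ((2 : ℝ) ^ R) ^ n := by
  have h1 : (2 : ℝ) ^ ((n : ℝ) * R) = ((2 : ℝ) ^ R) ^ n := by
    rw [mul_comm, Real.rpow_mul two_pos.le, Real.rpow_natCast]
  have h2 : 1 ≤ ((2 : ℝ) ^ R) ^ n := one_le_pow₀ (Real.one_le_rpow one_le_two hR)
  have h3 := (Nat.ceil_lt_add_one (zero_le_one.trans h2)).le
  rw [numMessages, h1]
  linarith

theorem measurable_extendZero (n j : ℕ) : Measurable fun h : Fin n → ℝ => extendZero h j := by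
  unfold extendZero
  split_ifs with hj
  · exact measurable_pi_apply _
  · exact measurable_const

theorem measurable_scalar_unstableState (a b c : ℝ) (i : ℕ) :
    Measurable fun y : ℕ → ℝ => (KParams.scalar 0 0 0 a b c).unstableState y i 0 := by
  induction i with
  | zero => exact measurable_pi_apply 0
  | succ i ih =>
    simp only [scalar_unstableState_succ]
    fun_prop

theorem measurable_nearestMessage {M : ℕ} (hM : 0 < M) :
    Measurable (nearestMessage hM) := by
  have h1 : Measurable fun t : ℝ => ⌊(t + 1 / 2) * M⌋₊ :=
    Nat.measurable_floor.comp ((measurable_id.add_const _).mul_const _)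
  exact (measurable_of_countable
    (fun k : ℕ => (⟨min k (M - 1), by omega⟩ : Fin M))).comp h1

theorem sk_code_isMeasurable (a : ℝ) {n M : ℕ} (hM : 0 < M) :
    ((skParams a).code n hM).IsMeasurable := by
  have hext (n : ℕ) : Measurable (extendZero : (Fin n → ℝ) → ℕ → ℝ) :=
    measurable_pi_lambda _ (measurable_extendZero n)
  refine ⟨fun i m => ?_, fun i => measurable_pi_apply _, ?_⟩
  · change Measurable fun h => (skParams a).input (fun _ => messagePoint M m) (extendZero h) i
    cases i with
    | zero => simp only [skParams, scalar_input_zero]; exact measurable_const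
    | succ i =>
      simp only [skParams_input_succ]
      exact (((measurable_scalar_unstableState _ _ _ i).comp (hext _)).sub_const _).const_mul _
  · change Measurable fun y => nearestMessage hM ((skParams a).estimate (extendZero y) n 0)
    simp only [skParams, scalar_estimate]
    exact (measurable_nearestMessage hM).comp
      (((measurable_scalar_unstableState _ _ _ _).comp (hext _)).const_mul _)

theorem sk_reliable [IsProbabilityMeasure μ] {σ : ℝ≥0} {w : ℕ → Ω → ℝ}
    (hw : IsWhiteGaussian μ σ w) {a R : ℝ} (hR : 0 ≤ R) (ha : 1 < a) (hRa : (2 : ℝ) ^ R < a) :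
    Reliable μ w ((skParams a).codeSeq R) := by
  refine ⟨fun n => sk_code_isMeasurable a _, ?_⟩
  have h0 : 0 < a := by positivity
  have h2 : 0 ≤ (2 : ℝ) ^ R := by positivity
  have hq0 : 0 ≤ (2 : ℝ) ^ R / a := by positivity
  have hlim : Tendsto (fun n : ℕ => ENNReal.ofReal
      (16 * (σ : ℝ) ^ 2 * (((2 : ℝ) ^ R / a) ^ n) ^ 2)) atTop (𝓝 0) := by
    have := ((tendsto_pow_atTop_nhds_zero_of_lt_one hq0 ((div_lt_one h0).2 hRa)).pow 2).const_mul
      (16 * (σ : ℝ) ^ 2)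
    simpa using ENNReal.tendsto_ofReal this
  refine tendsto_of_tendsto_of_tendsto_of_le_of_le' tendsto_const_nhds hlim
    (Eventually.of_forall fun _ => zero_le) ?_
  filter_upwards [eventually_gt_atTop 0] with n hn
  refine (sk_code_errorProb_le hw a ha hn (numMessages_pos R n)).trans
    (ENNReal.ofReal_le_ofReal ?_)
  have h3 := numMessages_le hR n
  have h4 : a⁻¹ ^ (2 * (n + 1)) ≤ (a⁻¹ ^ n) ^ 2 := by
    rw [← pow_mul]
    exact pow_le_pow_of_le_one (by positivity) (inv_le_one_of_one_le₀ ha.le) (by omega)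
  calc 4 * (numMessages R n : ℝ) ^ 2 * (σ : ℝ) ^ 2 * a⁻¹ ^ (2 * (n + 1))
    _ ≤ 4 * (2 * ((2 : ℝ) ^ R) ^ n) ^ 2 * (σ : ℝ) ^ 2 * (a⁻¹ ^ n) ^ 2 := by gcongr
    _ = 16 * (σ : ℝ) ^ 2 * (((2 : ℝ) ^ R / a) ^ n) ^ 2 := by
      rw [div_pow, inv_pow]; field_simp; ring

theorem sk_longRunPower [IsProbabilityMeasure μ] {σ : ℝ≥0} {w : ℕ → Ω → ℝ}
    (hw : IsWhiteGaussian μ σ w) {a : ℝ} (R : ℝ) (ha : 1 < a) :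
    LongRunPower μ w ((a ^ 2 - 1) * (σ : ℝ) ^ 2) ((skParams a).codeSeq R) := by
  have hlim : Tendsto (fun n : ℕ => ENNReal.ofReal (a ^ 4 / 4 / n + (a ^ 2 - 1) * (σ : ℝ) ^ 2))
      atTop (𝓝 (ENNReal.ofReal ((a ^ 2 - 1) * (σ : ℝ) ^ 2))) := by
    have := (tendsto_const_div_atTop_nhds_zero_nat (a ^ 4 / 4)).add_const
      ((a ^ 2 - 1) * (σ : ℝ) ^ 2)
    simpa using ENNReal.tendsto_ofReal this
  refine (limsup_le_limsup ?_).trans_eq hlim.limsup_eq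
  filter_upwards [eventually_gt_atTop 0] with n hn
  exact sk_code_power_le hw a ha hn (numMessages_pos R n)

end

/-! ### Mutual information -/

section MutualInfo

variable {Ω α β γ δ : Type*} [MeasurableSpace Ω] [MeasurableSpace α] [MeasurableSpace β]
  [MeasurableSpace γ] [MeasurableSpace δ]

theorem mutualInfo_comp_le (ν : Measure Ω) [IsFiniteMeasure ν] {X : Ω → α} {Y : Ω → β} {f : β → γ}
    (hX : Measurable X) (hY : Measurable Y) (hf : Measurable f) :
    mutualInfo ν X (fun ω => f (Y ω)) ≤ mutualInfo ν X Y := by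
  refine ENNReal.div_le_div_right ?_ _
  have h := InformationTheory.klDiv_map_le (ν.map fun ω => (X ω, Y ω))
    ((ν.map X).prod (ν.map Y)) (g := Prod.map id f) (measurable_id.prodMap hf)
  rwa [Measure.map_map (measurable_id.prodMap hf) (hX.prodMk hY),
    ← Measure.map_prod_map _ _ measurable_id hf, Measure.map_id, Measure.map_map hf hY] at h

/-- A further observation that depends on `X` only through `Y` does not increase the mutual
information. -/
theorem mutualInfo_prodMk_le (ν : Measure Ω) [IsFiniteMeasure ν] {X : Ω → α} {Y : Ω → β} {Z : Ω → γ}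
    (hX : Measurable X) (hY : Measurable Y) (hZ : Measurable Z) (κ : Kernel β γ) [IsMarkovKernel κ]
    (h : ν.map (fun ω => ((X ω, Y ω), Z ω)) =
      ν.map (fun ω => (X ω, Y ω)) ⊗ₘ κ.comap Prod.snd measurable_snd) :
    mutualInfo ν X (fun ω => (Y ω, Z ω)) ≤ mutualInfo ν X Y := by
  have hXY := hX.prodMk hY
  have hYZ := hY.prodMk hZ
  have he : Measurable fun p : (α × β) × γ => (p.1.1, (p.1.2, p.2)) := by fun_prop
  have h1 : ν.map (fun ω => (X ω, (Y ω, Z ω))) =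
      (ν.map (fun ω => (X ω, Y ω)) ⊗ₘ κ.comap Prod.snd measurable_snd).map
        fun p => (p.1.1, (p.1.2, p.2)) := by
    rw [← h, Measure.map_map he (hXY.prodMk hZ)]
    rfl
  -- Since κ does not see X, the product of the marginals also arises by appending κ. Both arguments
  -- of the divergence are then extended by the same kernel, which leaves it unchanged.
  have h2 : (ν.map X).prod (ν.map fun ω => (Y ω, Z ω)) =
      ((ν.map X).prod (ν.map Y) ⊗ₘ κ.comap Prod.snd measurable_snd).map
        fun p => (p.1.1, (p.1.2, p.2)) := by
    have h3 : ν.map (fun ω => (Y ω, Z ω)) = ν.map Y ⊗ₘ κ := by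
      refine Measure.ext_of_lintegral _ fun f hf => ?_
      have h4 := congrArg (fun ρ => ∫⁻ p, f (p.1.2, p.2) ∂ρ) h
      rw [lintegral_map (by fun_prop) (hXY.prodMk hZ), Measure.lintegral_compProd (by fun_prop),
        lintegral_map (by
          exact Measurable.lintegral_kernel_prod_right'
            (κ := κ.comap (Prod.snd : α × β → β) measurable_snd)
            (f := fun p : (α × β) × γ => f (p.1.2, p.2)) (by fun_prop)) hXY] at h4
      rw [lintegral_map hf hYZ, Measure.lintegral_compProd hf,
        lintegral_map hf.lintegral_kernel_prod_right' hY]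
      exact h4
    rw [h3]
    refine Measure.ext_of_lintegral _ fun f hf => ?_
    rw [lintegral_map hf he, Measure.lintegral_compProd (by exact hf.comp he),
      lintegral_prod _ hf.aemeasurable, lintegral_prod _ (Measurable.aemeasurable (by
          exact Measurable.lintegral_kernel_prod_right'
            (κ := κ.comap (Prod.snd : α × β → β) measurable_snd) (hf.comp he)))]
    refine lintegral_congr fun x => ?_
    rw [Measure.lintegral_compProd (by fun_prop)]
    rfl
  refine ENNReal.div_le_div_right ?_ _
  rw [h1, h2]
  refine (InformationTheory.klDiv_map_le _ _ he).trans_eq ?_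
  rw [InformationTheory.klDiv_compProd_left]

/-- The observation of `Z` can be dropped if its conditional law depends only on a function of the
other observation. -/
theorem mutualInfo_message_prodMk_le (μ : Measure Ω) [IsProbabilityMeasure μ] {M : ℕ} [NeZero M]
    {S : Ω → β} {Z : Ω → γ} (hS : Measurable S) (hZ : Measurable Z) (κ : Kernel δ γ)
    [IsMarkovKernel κ] {g : β → δ} (hg : Measurable g)
    (h : μ.map (fun ω => (S ω, Z ω)) = μ.map S ⊗ₘ κ.comap g hg)
    {s : Fin M → β → β} (hs : ∀ m, Measurable (s m)) (hgs : ∀ m b, g (s m b) = g b) :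
    mutualInfo (Code.jointMeasure μ M) Prod.fst (fun p => (s p.1 (S p.2), Z p.2)) ≤
      mutualInfo (Code.jointMeasure μ M) Prod.fst (fun p => s p.1 (S p.2)) := by
  have hY : Measurable fun p : Fin M × Ω => s p.1 (S p.2) :=
    measurable_from_prod_countable_right fun m => (hs m).comp hS
  have hZ' : Measurable fun p : Fin M × Ω => Z p.2 := hZ.comp measurable_snd
  have hY' := measurable_fst.prodMk hY
  refine mutualInfo_prodMk_le _ measurable_fst hY hZ' (κ.comap g hg) ?_
  refine Measure.ext_of_lintegral _ fun f hf => ?_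
  have hF : Measurable fun q : Fin M × β => ∫⁻ z, f (q, z) ∂(κ (g q.2)) :=
    Measurable.lintegral_kernel_prod_right'
      (κ := (κ.comap g hg).comap (Prod.snd : Fin M × β → β) measurable_snd) hf
  rw [lintegral_map hf (hY'.prodMk hZ'), Measure.lintegral_compProd hf]
  simp only [Kernel.comap_apply]
  rw [lintegral_map hF hY', lintegral_jointMeasure (by exact hf.comp (hY'.prodMk hZ')),
    lintegral_jointMeasure (by exact hF.comp hY')]
  congr 1
  refine Finset.sum_congr rfl fun m _ => ?_
  have h1 : Measurable fun q : β × γ => f ((m, s m q.1), q.2) :=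
    hf.comp (((measurable_const.prodMk ((hs m).comp measurable_fst))).prodMk measurable_snd)
  -- For a fixed message the factorization `h` is transported along `s m`; by `hgs` this does not
  -- alter what the kernel sees.
  have h4 := congrArg (fun ρ => ∫⁻ q, f ((m, s m q.1), q.2) ∂ρ) h
  rw [lintegral_map h1 (hS.prodMk hZ), Measure.lintegral_compProd h1,
    lintegral_map h1.lintegral_kernel_prod_right' hS] at h4
  simp only [Kernel.comap_apply] at h4
  simp only [hgs]
  exact h4

end MutualInfo

/-! ### Information about a uniform message through densities -/

section Mixture

variable {E : Type*} [MeasurableSpace E]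

theorem klFun_le (x : ℝ≥0) :
    ENNReal.ofReal (InformationTheory.klFun x) ≤ 1 + x * ENNReal.ofReal (Real.log x) := by
  have h1 : InformationTheory.klFun x ≤ 1 + x * Real.log x := by
    rw [InformationTheory.klFun_apply]
    linarith [x.2]
  refine (ENNReal.ofReal_le_ofReal h1).trans (ENNReal.ofReal_add_le.trans ?_)
  rw [ENNReal.ofReal_one, ENNReal.ofReal_mul (by exact x.2), ENNReal.ofReal_coe_nnreal]

/-- Let r be the average of the densities and g = q/r ≤ M. Up to the constant 1, the divergence is
at most the mean of log⁺ g. On G m one has q ≤ K and log g ≤ g, and the average of g over the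
messages is at most 1, so this part costs at most K · l(D). Off G m the bound log g ≤ log M applies
on a set of probability at most ε. -/
theorem klDiv_mixture_le (l : Measure E) [SigmaFinite l] {M : ℕ} [NeZero M] {q : Fin M → E → ℝ≥0}
    (hq : ∀ m, Measurable (q m)) (hq1 : ∀ m, ∫⁻ y, q m y ∂l = 1) {G : Fin M → Set E} {D : Set E}
    (hG : ∀ m, MeasurableSet (G m)) (hD : MeasurableSet D) (hGD : ∀ m, G m ⊆ D) {K : ℝ≥0}
    (hK : ∀ m, ∀ y ∈ G m, q m y ≤ K) {ε : ℝ≥0∞} (hε : ∀ m, ∫⁻ y in (G m)ᶜ, q m y ∂l ≤ ε) :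
    InformationTheory.klDiv
      (((uniformOn (Set.univ : Set (Fin M))).prod l).withDensity fun p => (q p.1 p.2 : ℝ≥0∞))
      ((uniformOn (Set.univ : Set (Fin M))).prod
        (l.withDensity fun y => (((∑ m, q m y) / M : ℝ≥0) : ℝ≥0∞))) ≤
      1 + K * l D + ε * ENNReal.ofReal (Real.log M) := by
  set u := uniformOn (Set.univ : Set (Fin M)) with hu
  set r : E → ℝ≥0 := fun y => (∑ m, q m y) / M with hr
  have hM : (M : ℝ≥0) ≠ 0 := Nat.cast_ne_zero.2 (NeZero.ne M)
  have hM1 : (1 : ℝ) ≤ M := Nat.one_le_cast.2 (Nat.one_le_iff_ne_zero.2 (NeZero.ne M))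
  have hMe : (M : ℝ≥0∞) ≠ 0 := Nat.cast_ne_zero.2 (NeZero.ne M)
  have hrm : Measurable r := (Finset.measurable_sum _ fun m _ => hq m).div_const _
  have hqm : Measurable fun p : Fin M × E => q p.1 p.2 := measurable_from_prod_countable_right hq
  set g : Fin M × E → ℝ≥0 := fun p => q p.1 p.2 / r p.2 with hg
  have hgm : Measurable g := hqm.div (hrm.comp measurable_snd)
  have hqr (m : Fin M) (y : E) : q m y ≤ M * r y := by
    rw [hr]
    simp only
    rw [mul_div_cancel₀ _ hM]
    exact Finset.single_le_sum (f := fun m => q m y) (fun _ _ => zero_le) (Finset.mem_univ m)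
  -- Where r vanishes, every q m vanishes too, so the convention for division by zero is harmless.
  have hgr (m : Fin M) (y : E) : r y * g (m, y) = q m y := by
    by_cases h0 : r y = 0
    · have := hqr m y
      simp only [h0, mul_zero, nonpos_iff_eq_zero] at this
      simp [h0, this]
    · exact mul_div_cancel₀ _ h0
  have hgM (m : Fin M) (y : E) : g (m, y) ≤ M := by
    by_cases h0 : r y = 0
    · simp [hg, h0]
    · exact (div_le_iff₀ (pos_iff_ne_zero.2 h0)).2 (hqr m y)
  have hgsum (y : E) : ∑ m, g (m, y) ≤ M := by
    by_cases h0 : r y = 0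
    · simp [hg, h0]
    · simp only [hg, ← Finset.sum_div]
      rw [div_le_iff₀ (pos_iff_ne_zero.2 h0), hr]
      simp only
      rw [mul_div_cancel₀ _ hM]
  have hN : u.prod (l.withDensity fun y => (r y : ℝ≥0∞)) =
      (u.prod l).withDensity fun p => (r p.2 : ℝ≥0∞) :=
    prod_withDensity_right hrm.coe_nnreal_ennreal
  have hJ : (u.prod l).withDensity (fun p => (q p.1 p.2 : ℝ≥0∞)) =
      (u.prod (l.withDensity fun y => (r y : ℝ≥0∞))).withDensity fun p => (g p : ℝ≥0∞) := by
    rw [hN, ← withDensity_mul _ (by exact (hrm.comp measurable_snd).coe_nnreal_ennreal)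
      hgm.coe_nnreal_ennreal]
    congr 1
    funext p
    rw [Pi.mul_apply, ← ENNReal.coe_mul]
    exact congrArg _ (hgr p.1 p.2).symm
  have hrint : ∫⁻ y, r y ∂l = 1 := by
    have h1 (y : E) : (r y : ℝ≥0∞) = (∑ m, (q m y : ℝ≥0∞)) * (M : ℝ≥0∞)⁻¹ := by
      rw [hr]
      simp only
      rw [ENNReal.coe_div hM, ENNReal.ofNNReal_finsetSum, ENNReal.coe_natCast, div_eq_mul_inv]
    simp only [h1]
    rw [lintegral_mul_const _ (Finset.measurable_sum _ fun m _ => (hq m).coe_nnreal_ennreal),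
      lintegral_finsetSum _ fun m _ => (hq m).coe_nnreal_ennreal]
    simp [hq1, ENNReal.mul_inv_cancel hMe]
  have : IsProbabilityMeasure (l.withDensity fun y => (r y : ℝ≥0∞)) := ⟨by simpa using hrint⟩
  have : IsFiniteMeasure ((u.prod (l.withDensity fun y => (r y : ℝ≥0∞))).withDensity
      fun p => (g p : ℝ≥0∞)) := by
    rw [← hJ]
    refine ⟨?_⟩
    rw [withDensity_apply _ MeasurableSet.univ, Measure.restrict_univ,
      lintegral_prod _ hqm.coe_nnreal_ennreal.aemeasurable, lintegral_uniformOn_fin]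
    simp [hq1, ENNReal.div_self hMe]
  rw [hJ, InformationTheory.klDiv_eq_lintegral_klFun_of_ac (withDensity_absolutelyContinuous _ _)]
  have hpt (m : Fin M) (y : E) : (q m y : ℝ≥0∞) * ENNReal.ofReal (Real.log (g (m, y))) ≤
      D.indicator (fun y => (K : ℝ≥0∞) * g (m, y)) y +
        ENNReal.ofReal (Real.log M) * (G m)ᶜ.indicator (fun y => (q m y : ℝ≥0∞)) y := by
    by_cases hy : y ∈ G m
    · rw [Set.indicator_of_mem (hGD m hy)]
      refine le_add_right (mul_le_mul' (ENNReal.coe_le_coe.2 (hK m y hy)) ?_)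
      rw [← ENNReal.ofReal_coe_nnreal]
      exact ENNReal.ofReal_le_ofReal (Real.log_le_self (g (m, y)).2)
    · rw [Set.indicator_of_mem (show y ∈ (G m)ᶜ from hy), mul_comm (q m y : ℝ≥0∞)]
      refine le_add_left (mul_le_mul' (ENNReal.ofReal_le_ofReal ?_) le_rfl)
      rcases eq_or_ne (g (m, y)) 0 with h0 | h0
      · rw [h0, NNReal.coe_zero, Real.log_zero]
        exact Real.log_nonneg hM1
      · exact Real.log_le_log (NNReal.coe_pos.2 (pos_iff_ne_zero.2 h0)) (by exact_mod_cast hgM m y)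
  have hlogm : Measurable fun p : Fin M × E => ENNReal.ofReal (Real.log (g p)) :=
    (Real.measurable_log.comp hgm.coe_nnreal_real).ennreal_ofReal
  calc ∫⁻ p, ENNReal.ofReal (InformationTheory.klFun (((u.prod (l.withDensity fun y =>
          (r y : ℝ≥0∞))).withDensity fun p => (g p : ℝ≥0∞)).rnDeriv
          (u.prod (l.withDensity fun y => (r y : ℝ≥0∞))) p).toReal)
          ∂(u.prod (l.withDensity fun y => (r y : ℝ≥0∞)))
    _ ≤ ∫⁻ p, 1 + g p * ENNReal.ofReal (Real.log (g p))
          ∂(u.prod (l.withDensity fun y => (r y : ℝ≥0∞))) := by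
        refine lintegral_mono_ae ?_
        filter_upwards [Measure.rnDeriv_withDensity (u.prod (l.withDensity fun y => (r y : ℝ≥0∞)))
          hgm.coe_nnreal_ennreal] with p hp
        rw [hp]
        exact klFun_le (g p)
    _ = 1 + ∫⁻ p, (q p.1 p.2 : ℝ≥0∞) * ENNReal.ofReal (Real.log (g p)) ∂(u.prod l) := by
        rw [lintegral_add_left measurable_const, lintegral_one, measure_univ, hN,
          lintegral_withDensity_eq_lintegral_mul _
            (by exact (hrm.comp measurable_snd).coe_nnreal_ennreal)
            (by exact hgm.coe_nnreal_ennreal.mul hlogm)]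
        congr 1
        refine lintegral_congr fun p => ?_
        rw [Pi.mul_apply, ← mul_assoc, ← ENNReal.coe_mul]
        exact congrArg (fun t : ℝ≥0 => (t : ℝ≥0∞) * _) (hgr p.1 p.2)
    _ = 1 + (∑ m, ∫⁻ y, (q m y : ℝ≥0∞) * ENNReal.ofReal (Real.log (g (m, y))) ∂l) / M := by
        rw [lintegral_prod _ (by exact (hqm.coe_nnreal_ennreal.mul hlogm).aemeasurable),
          lintegral_uniformOn_fin]
    _ ≤ 1 + (∑ m, (∫⁻ y in D, (K : ℝ≥0∞) * g (m, y) ∂l +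
          ENNReal.ofReal (Real.log M) * ε)) / M := by
        gcongr with m
        have hgm' : Measurable fun y => (K : ℝ≥0∞) * g (m, y) :=
          (hgm.comp measurable_prodMk_left).coe_nnreal_ennreal.const_mul _
        refine (lintegral_mono (hpt m)).trans ?_
        rw [lintegral_add_left (hgm'.indicator hD), lintegral_indicator hD,
          lintegral_const_mul _ ((hq m).coe_nnreal_ennreal.indicator (hG m).compl),
          lintegral_indicator (hG m).compl]
        gcongr
        exact hε m
    _ = 1 + (∫⁻ y in D, (K : ℝ≥0∞) * ((∑ m, g (m, y) : ℝ≥0) : ℝ≥0∞) ∂l) / M +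
          ENNReal.ofReal (Real.log M) * ε := by
        rw [Finset.sum_add_distrib, ← lintegral_finsetSum _ fun m _ => by
          exact (hgm.comp measurable_prodMk_left).coe_nnreal_ennreal.const_mul _]
        simp only [← Finset.mul_sum, ENNReal.ofNNReal_finsetSum, Finset.sum_const, Finset.card_univ,
          Fintype.card_fin, nsmul_eq_mul]
        rw [ENNReal.add_div, mul_comm (M : ℝ≥0∞), ← mul_assoc,
          ENNReal.mul_div_cancel_right hMe (ENNReal.natCast_ne_top M), add_assoc]
    _ ≤ 1 + (∫⁻ y in D, (K : ℝ≥0∞) * M ∂l) / M + ENNReal.ofReal (Real.log M) * ε := by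
        gcongr with y
        exact_mod_cast hgsum y
    _ = 1 + K * l D + ε * ENNReal.ofReal (Real.log M) := by
        rw [lintegral_const, Measure.restrict_apply_univ, mul_right_comm, mul_div_assoc,
          ENNReal.div_self hMe (ENNReal.natCast_ne_top M), mul_one,
          mul_comm (ENNReal.ofReal _)]

/-- For a uniform message the output law is the uniform mixture of the conditional densities, so the
mutual information is the divergence of `klDiv_mixture_le`. -/
theorem mutualInfo_message_le {Ω : Type*} [MeasurableSpace Ω] (μ : Measure Ω)
    [IsProbabilityMeasure μ] (l : Measure E) [SigmaFinite l] {M : ℕ} [NeZero M]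
    {Y : Fin M × Ω → E} (hY : Measurable Y) {q : Fin M → E → ℝ≥0}
    (hq : ∀ m, Measurable (q m))
    (hYq : ∀ m, μ.map (fun ω => Y (m, ω)) = l.withDensity fun y => (q m y : ℝ≥0∞))
    {G : Fin M → Set E} {D : Set E} (hG : ∀ m, MeasurableSet (G m)) (hD : MeasurableSet D)
    (hGD : ∀ m, G m ⊆ D) {K : ℝ≥0} (hK : ∀ m, ∀ y ∈ G m, q m y ≤ K) {ε : ℝ≥0∞}
    (hε : ∀ m, μ {ω | Y (m, ω) ∉ G m} ≤ ε) :
    mutualInfo (Code.jointMeasure μ M) Prod.fst Y ≤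
      (1 + K * l D + ε * ENNReal.ofReal (Real.log M)) / ENNReal.ofReal (Real.log 2) := by
  refine ENNReal.div_le_div_right ?_ _
  have hMe : (M : ℝ≥0∞) ≠ 0 := Nat.cast_ne_zero.2 (NeZero.ne M)
  have hM : (M : ℝ≥0) ≠ 0 := Nat.cast_ne_zero.2 (NeZero.ne M)
  have hYm (m : Fin M) : Measurable fun ω => Y (m, ω) := hY.comp measurable_prodMk_left
  have hqm : Measurable fun p : Fin M × E => q p.1 p.2 := measurable_from_prod_countable_right hq
  have hsum : Measurable fun y => (∑ m, q m y) / (M : ℝ≥0) :=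
    (Finset.measurable_sum _ fun m _ => hq m).div_const _
  have hlint (m : Fin M) {f : E → ℝ≥0∞} (hf : Measurable f) :
      ∫⁻ ω, f (Y (m, ω)) ∂μ = ∫⁻ y, q m y * f y ∂l := by
    rw [← lintegral_map hf (hYm m), hYq,
      lintegral_withDensity_eq_lintegral_mul _ (hq m).coe_nnreal_ennreal hf]
    rfl
  have h1 : (Code.jointMeasure μ M).map (fun p => (p.1, Y p)) =
      ((uniformOn (Set.univ : Set (Fin M))).prod l).withDensity
        fun p => (q p.1 p.2 : ℝ≥0∞) := by
    refine Measure.ext_of_lintegral _ fun f hf => ?_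
    rw [lintegral_map hf (measurable_fst.prodMk hY),
      lintegral_jointMeasure (by exact hf.comp (measurable_fst.prodMk hY)),
      lintegral_withDensity_eq_lintegral_mul _ hqm.coe_nnreal_ennreal hf,
      lintegral_prod _ (hqm.coe_nnreal_ennreal.mul hf).aemeasurable, lintegral_uniformOn_fin]
    congr 1
    refine Finset.sum_congr rfl fun m _ => ?_
    exact hlint m (hf.comp measurable_prodMk_left)
  have h2 : (Code.jointMeasure μ M).map Prod.fst = uniformOn (Set.univ : Set (Fin M)) := by
    rw [Code.jointMeasure, Measure.map_fst_prod, measure_univ, one_smul]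
  have h3 : (Code.jointMeasure μ M).map Y =
      l.withDensity fun y => (((∑ m, q m y) / M : ℝ≥0) : ℝ≥0∞) := by
    refine Measure.ext_of_lintegral _ fun f hf => ?_
    rw [lintegral_map hf hY, lintegral_jointMeasure (by exact hf.comp hY),
      lintegral_withDensity_eq_lintegral_mul _ hsum.coe_nnreal_ennreal hf,
      Finset.sum_congr rfl fun m _ => hlint m hf,
      ← lintegral_finsetSum _ (by exact fun m _ => (hq m).coe_nnreal_ennreal.mul hf), div_eq_mul_inv,
      ← lintegral_mul_const _
        (by exact Finset.measurable_sum _ fun m _ => (hq m).coe_nnreal_ennreal.mul hf)]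
    refine lintegral_congr fun y => ?_
    rw [Pi.mul_apply, ENNReal.coe_div hM, ENNReal.ofNNReal_finsetSum, ENNReal.coe_natCast,
      div_eq_mul_inv, ← Finset.sum_mul, mul_right_comm]
  rw [h1, h2, h3]
  refine klDiv_mixture_le l hq (fun m => ?_) hG hD hGD hK fun m => ?_
  · have := hlint m (f := fun _ => 1) measurable_const
    simpa using this.symm
  · refine le_trans (le_of_eq ?_) (hε m)
    rw [← withDensity_apply _ (hG m).compl, ← hYq, Measure.map_apply (hYm m) (hG m).compl]
    rfl

end Mixture

/-! ### Secrecy of the scheme -/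

/-- For additive noise with a density, a bounded message point carries little information compared
to the logarithm of the number of messages. -/
theorem exists_mutualInfo_shift_le {E Ω : Type*} [NormedAddCommGroup E] [MeasurableSpace E]
    [BorelSpace E] [SecondCountableTopology E] [ProperSpace E] (l : Measure E) [SigmaFinite l]
    [l.IsAddLeftInvariant] [IsFiniteMeasureOnCompacts l] [MeasurableSpace Ω] (μ : Measure Ω)
    [IsProbabilityMeasure μ] {S : Ω → E} (hS : Measurable S) (hac : μ.map S ≪ l) (r : ℝ) {ε : ℝ}
    (hε : 0 < ε) :
    ∃ C : ℝ, 0 ≤ C ∧ ∀ (M : ℕ) [NeZero M] (t : Fin M → E), (∀ m, ‖t m‖ ≤ r) →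
      mutualInfo (Code.jointMeasure μ M) Prod.fst (fun p => t p.1 + S p.2) ≤
        ENNReal.ofReal ((C + ε * Real.log M) / Real.log 2) := by
  set f : E → ℝ≥0 := fun y => ((μ.map S).rnDeriv l y).toNNReal with hf
  have : IsProbabilityMeasure (μ.map S) := Measure.isProbabilityMeasure_map hS.aemeasurable
  have hfm : Measurable f := (Measure.measurable_rnDeriv _ _).ennreal_toNNReal
  have hSf : μ.map S = l.withDensity fun y => (f y : ℝ≥0∞) := by
    conv_lhs => rw [← Measure.withDensity_rnDeriv_eq _ _ hac]
    refine withDensity_congr_ae ?_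
    filter_upwards [Measure.rnDeriv_lt_top (μ.map S) l] with y hy
    exact (ENNReal.coe_toNNReal hy.ne).symm
  -- The density need be neither bounded nor of finite entropy. It is truncated in height and in
  -- space; these sets exhaust E, so their complements have small probability.
  set B : ℕ → Set E := fun k => {y | f y ≤ k} ∩ Metric.closedBall 0 k with hB
  have hBm (k : ℕ) : MeasurableSet (B k) :=
    (measurableSet_le hfm measurable_const).inter Metric.isClosed_closedBall.measurableSet
  have hlim : Tendsto ((μ.map S) ∘ fun k => (B k)ᶜ) atTop (𝓝 0) := by
    have h1 : ⋂ k, (B k)ᶜ = ∅ := by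
      rw [← Set.compl_iUnion, Set.compl_empty_iff, Set.eq_univ_iff_forall]
      intro y
      obtain ⟨k1, hk1⟩ := exists_nat_ge (f y)
      obtain ⟨k2, hk2⟩ := exists_nat_ge ‖y‖
      refine Set.mem_iUnion.2 ⟨max k1 k2, hk1.trans (by simp), ?_⟩
      rw [mem_closedBall_zero_iff]
      exact hk2.trans (by simp)
    have h2 : Antitone fun k => (B k)ᶜ := by
      intro i j hij
      refine Set.compl_subset_compl.2 (Set.inter_subset_inter (fun y hy => ?_)
        (Metric.closedBall_subset_closedBall (by exact_mod_cast hij)))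
      exact le_trans (b := (i : ℝ≥0)) hy (by exact_mod_cast hij)
    have h3 := tendsto_measure_iInter_atTop (μ := μ.map S)
      (fun k => (hBm k).compl.nullMeasurableSet) h2 ⟨0, measure_ne_top _ _⟩
    rwa [h1, measure_empty] at h3
  obtain ⟨k, hk⟩ := (ENNReal.tendsto_nhds_zero.1 hlim (ENNReal.ofReal ε)
    (ENNReal.ofReal_pos.2 hε)).exists
  -- One ball contains all translates of B k by vectors of norm at most r, so the constant depends
  -- on ε and r but not on the messages.
  set D : Set E := Metric.closedBall 0 (k + r) with hD
  refine ⟨1 + k * l.real D, by positivity, fun M _ t ht => ?_⟩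
  have hM1 : (1 : ℝ) ≤ M := Nat.one_le_cast.2 (Nat.one_le_iff_ne_zero.2 (NeZero.ne M))
  have hY : Measurable fun p : Fin M × Ω => t p.1 + S p.2 :=
    measurable_from_prod_countable_right fun m => by exact hS.const_add (t m)
  have hsub (m : Fin M) : Measurable fun y => -t m + y := measurable_id.const_add _
  refine (mutualInfo_message_le μ l hY (q := fun m y => f (-t m + y)) (K := k)
    (G := fun m => {y | -t m + y ∈ B k}) (D := D) (ε := ENNReal.ofReal ε)
    (fun m => hfm.comp (hsub m)) (fun m => ?_) (fun m => hsub m (hBm k))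
    Metric.isClosed_closedBall.measurableSet (fun m y hy => ?_) (fun m y hy => hy.1)
    fun m => ?_).trans_eq ?_
  · have h1 : μ.map (fun ω => t m + S ω) = (μ.map S).map (fun y => t m + y) :=
      (Measure.map_map (measurable_id.const_add _) hS).symm
    rw [h1, hSf]
    refine Measure.ext_of_lintegral _ fun h hh => ?_
    rw [lintegral_map hh (by exact measurable_id.const_add _),
      lintegral_withDensity_eq_lintegral_mul _ hfm.coe_nnreal_ennreal
        (by exact hh.comp (measurable_id.const_add _)),
      lintegral_withDensity_eq_lintegral_mul _
        (by exact (hfm.comp (hsub m)).coe_nnreal_ennreal) hh]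
    conv_rhs => rw [← lintegral_add_left_eq_self _ (t m)]
    simp
  · rw [hD, mem_closedBall_zero_iff]
    have h1 : ‖-t m + y‖ ≤ k := mem_closedBall_zero_iff.1 hy.2
    calc ‖y‖ = ‖(-t m + y) + t m‖ := by congr 1; abel
      _ ≤ k + r := (norm_add_le _ _).trans (add_le_add h1 (ht m))
  · refine le_trans (le_of_eq ?_) hk
    rw [Function.comp_apply, Measure.map_apply hS (hBm k).compl]
    congr 1
    ext ω
    simp
  · rw [ENNReal.ofReal_div_of_pos (Real.log_pos one_lt_two),
      ENNReal.ofReal_add (by positivity) (mul_nonneg hε.le (Real.log_nonneg hM1)),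
      ENNReal.ofReal_add zero_le_one (by positivity), ENNReal.ofReal_mul hε.le,
      ENNReal.ofReal_mul (Nat.cast_nonneg k), ENNReal.ofReal_one,
      ofReal_measureReal (by exact measure_closedBall_lt_top.ne)]
    simp

/-! ### Noises with finite memory -/

section FiniteMemory

variable {Ω S : Type*} [MeasurableSpace Ω] [MeasurableSpace S] [StandardBorelSpace S]
  [Nonempty S] {μ : Measure Ω} [IsProbabilityMeasure μ]

/-- The last `d` entries of a history of length `k`. -/
def lastEntries {d k : ℕ} (h : d ≤ k) (g : Fin k → S) (j : Fin d) : S :=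
  g ⟨k - d + j, by omega⟩

omit [StandardBorelSpace S] [Nonempty S] in
theorem measurable_lastEntries {d k : ℕ} (h : d ≤ k) :
    Measurable (lastEntries h : (Fin k → S) → Fin d → S) :=
  measurable_pi_lambda _ fun _ => measurable_pi_apply _

/-- Turns the almost sure equality of conditional laws into a factorization of the joint law, the
form that `mutualInfo_message_prodMk_le` consumes. -/
theorem HasFiniteMemory.map_eq_compProd {X : ℕ → Ω → S} {d : ℕ} (h : HasFiniteMemory μ X d)
    (hX : ∀ k, Measurable (X k)) {k : ℕ} (hk : d ≤ k) :
    μ.map (fun ω => ((fun j : Fin k => X j ω), X k ω)) =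
      μ.map (fun ω (j : Fin k) => X j ω) ⊗ₘ
        (condDistrib (X k) (fun ω (j : Fin d) => X (k - d + j) ω) μ).comap (lastEntries hk)
          (measurable_lastEntries hk) := by
  have hpast : Measurable fun ω (j : Fin k) => X j ω := measurable_pi_lambda _ fun j => hX j
  rw [← compProd_map_condDistrib (hX k).aemeasurable]
  refine Measure.ext_of_lintegral _ fun f hf => ?_
  rw [Measure.lintegral_compProd hf, Measure.lintegral_compProd hf,
    lintegral_map hf.lintegral_kernel_prod_right' hpast,
    lintegral_map hf.lintegral_kernel_prod_right' hpast]
  refine lintegral_congr_ae ?_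
  filter_upwards [h k hk] with ω hω
  rw [hω]
  rfl

end FiniteMemory

/-! ### The leakage of the scheme -/

section

variable {Ω : Type*} [MeasurableSpace Ω] {μ : Measure Ω} [IsProbabilityMeasure μ] {σ : ℝ≥0}
  {w v vt vh : ℕ → Ω → ℝ}

/-- The translation of the first entry of a sequence by `(c, c, c)`. -/
def firstShift (c : ℝ) (k : ℕ) (j : Fin k) : ℝ × ℝ × ℝ := if (j : ℕ) = 0 then (c, c, c) else 0

theorem norm_firstShift_le {c r : ℝ} (hc : |c| ≤ r) (k : ℕ) : ‖firstShift c k‖ ≤ r := by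
  have hr : 0 ≤ r := (abs_nonneg c).trans hc
  refine (pi_norm_le_iff_of_nonneg hr).2 fun j => ?_
  unfold firstShift
  split_ifs
  · simpa [Prod.norm_def] using hc
  · simpa using hr

/-- The eavesdropper's view is a function of the shifted noises and the forward noise. -/
noncomputable def eveMap (a : ℝ) {n : ℕ} (p : (Fin n → ℝ × ℝ × ℝ) × (ℕ → ℝ)) (i : Fin n) :
    ℝ × ℝ × ℝ :=
  (noiseInput a p.2 i + (p.1 i).1, noiseInput a p.2 i + p.2 i + (p.1 i).2.1,
    noiseInput a p.2 i + p.2 i + (p.1 i).2.2)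

theorem measurable_eveMap (a : ℝ) {n : ℕ} :
    Measurable (eveMap a : (Fin n → ℝ × ℝ × ℝ) × (ℕ → ℝ) → Fin n → ℝ × ℝ × ℝ) := by
  refine measurable_pi_lambda _ fun i => ?_
  have h1 : Measurable fun p : (Fin n → ℝ × ℝ × ℝ) × (ℕ → ℝ) => noiseInput a p.2 i :=
    (measurable_noiseInput a i).comp measurable_snd
  unfold eveMap
  fun_prop

/-- The term a² x of the first input reappears unchanged in the first output and in its feedback,
hence the equal components of `firstShift`. -/
theorem sk_code_eveObs {a : ℝ} (ha : 1 < a) {n M : ℕ} (hM : 0 < M) (m : Fin M)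
    (w v vt vh : ℕ → ℝ) :
    ((skParams a).code n hM).eveObs m w v vt vh =
      eveMap a (firstShift (a ^ 2 * messagePoint M m) n + fun j : Fin n => (v j, vt j, vh j), w) := by
  funext i
  simp only [Code.eveObs, code_feedback, Code.output_eq, sk_code_input hM m w ha, eveMap,
    firstShift, Pi.add_apply]
  split_ifs
  · simp only [Prod.mk_add_mk, Prod.mk.injEq]
    refine ⟨?_, ?_, ?_⟩ <;> ring
  · simp

theorem firstShift_add_succ {S : ℕ → ℝ × ℝ × ℝ} (c : ℝ) {k : ℕ} (hk : 0 < k) :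
    (firstShift c (k + 1) + fun j : Fin (k + 1) => S j) =
      fun j : Fin (k + 1) => if h : (j : ℕ) < k then
        (firstShift c k + fun j : Fin k => S j) ⟨j, h⟩ else S k := by
  funext j
  by_cases h : (j : ℕ) < k
  · simp [h, firstShift]
  · have h1 : (j : ℕ) = k := by omega
    simp [firstShift, h1, hk.ne']

/-- The strict inequality d < k keeps index 0, the only translated one, out of the window. -/
theorem lastEntries_firstShift_add {d k : ℕ} (h : d < k) (c : ℝ) (g : Fin k → ℝ × ℝ × ℝ) :
    lastEntries h.le (firstShift c k + g) = lastEntries h.le g := by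
  funext j
  simp only [lastEntries, Pi.add_apply, firstShift]
  rw [if_neg (by omega), zero_add]

/-- From time d + 1 on, the law of a new noise triple given the past depends only on a window that
misses the translated entry, so observing it reveals nothing more about the message. -/
theorem mutualInfo_firstShift_le {X : ℕ → Ω → ℝ × ℝ × ℝ} {d : ℕ} (h : HasFiniteMemory μ X d)
    (hX : ∀ k, Measurable (X k)) {M : ℕ} [NeZero M] (c : Fin M → ℝ) {n : ℕ} (hn : d + 1 ≤ n) :
    mutualInfo (Code.jointMeasure μ M) Prod.fst
        (fun p => firstShift (c p.1) n + fun j : Fin n => X j p.2) ≤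
      mutualInfo (Code.jointMeasure μ M) Prod.fst
        (fun p => firstShift (c p.1) (d + 1) + fun j : Fin (d + 1) => X j p.2) := by
  induction n, hn using Nat.le_induction with
  | base => exact le_rfl
  | succ k hk ih =>
    refine le_trans ?_ ih
    have hpast : Measurable fun ω (j : Fin k) => X j ω := measurable_pi_lambda _ fun j => hX j
    have h1 := mutualInfo_message_prodMk_le μ hpast (hX k) _ (measurable_lastEntries _)
      (h.map_eq_compProd hX (show d ≤ k by omega)) (s := fun m g => firstShift (c m) k + g)
      (fun m => measurable_id.const_add _) (fun m g => lastEntries_firstShift_add (by omega) _ g)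
    refine le_trans ?_ h1
    have hY : Measurable fun p : Fin M × Ω =>
        (firstShift (c p.1) k + (fun j : Fin k => X j p.2), X k p.2) :=
      measurable_from_prod_countable_right fun m =>
        (hpast.const_add (firstShift (c m) k)).prodMk (hX k)
    have hf : Measurable fun (p : (Fin k → ℝ × ℝ × ℝ) × (ℝ × ℝ × ℝ)) (j : Fin (k + 1)) =>
        if h : (j : ℕ) < k then p.1 ⟨j, h⟩ else p.2 := by
      refine measurable_pi_lambda _ fun j => ?_
      split_ifs
      · exact (measurable_pi_apply _).comp measurable_fst
      · exact measurable_snd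
    have h2 := mutualInfo_comp_le (Code.jointMeasure μ M) measurable_fst hY hf
    refine le_trans (le_of_eq ?_) h2
    congr 1
    funext p
    exact firstShift_add_succ (S := fun j => X j p.2) (c p.1) (by omega)

/-- The view is enlarged to the translated noises together with w; then w is dropped by
independence, the late noises by finite memory, and the remaining d + 1 triples are handled by the
density bound. The constants are chosen before n and M. -/
theorem sk_leakage_le (hch : IsAWGNWiretap μ σ w v vt vh) {a : ℝ} (ha : 1 < a) {ε : ℝ}
    (hε : 0 < ε) :
    ∃ C : ℝ, 0 ≤ C ∧ ∃ d : ℕ, ∀ n, d < n → ∀ (M : ℕ) (hM : 0 < M),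
      ((skParams a).code n hM).leakage μ w v vt vh ≤
        ENNReal.ofReal ((C + ε * Real.log M) / Real.log 2) := by
  obtain ⟨d, hd⟩ := hch.finiteMemory
  set X : ℕ → Ω → ℝ × ℝ × ℝ := fun k ω => (v k ω, vt k ω, vh k ω) with hXdef
  have hX (k : ℕ) : Measurable (X k) :=
    (hch.measurable_v k).prodMk ((hch.measurable_vt k).prodMk (hch.measurable_vh k))
  have hpast (n : ℕ) : Measurable fun ω (j : Fin n) => X j ω :=
    measurable_pi_lambda _ fun j => hX j
  have hW : Measurable fun ω k => w k ω := measurable_pi_lambda _ hch.measurable_w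
  have : IsProbabilityMeasure (μ.map fun ω k => w k ω) :=
    Measure.isProbabilityMeasure_map hW.aemeasurable
  have : (volume : Measure (ℝ × ℝ)).IsAddLeftInvariant := by
    rw [Measure.volume_eq_prod]; infer_instance
  have : (volume : Measure (ℝ × ℝ × ℝ)).IsAddLeftInvariant := by
    rw [Measure.volume_eq_prod]; infer_instance
  have : (volume : Measure (Fin (d + 1) → ℝ × ℝ × ℝ)).IsAddLeftInvariant := by
    exact Pi.isAddLeftInvariant_volume
  obtain ⟨C, hC, hbound⟩ := exists_mutualInfo_shift_le volume μ (hpast (d + 1))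
    (hch.density (d + 1)) (a ^ 2 * (1 / 2)) hε
  refine ⟨C, hC, d, fun n hn M hM => ?_⟩
  have : NeZero M := ⟨hM.ne'⟩
  have hindep : μ.map (fun ω => ((fun j : Fin n => X j ω), fun k => w k ω)) =
      μ.map (fun ω (j : Fin n) => X j ω) ⊗ₘ
        (Kernel.const Unit (μ.map fun ω k => w k ω)).comap (fun _ => ()) measurable_const := by
    have h1 : IndepFun (fun ω (j : Fin n) => X j ω) (fun ω k => w k ω) μ :=
      (hch.indep.comp measurable_id (ψ := fun x (j : Fin n) => x j)
        (measurable_pi_lambda _ fun j => measurable_pi_apply _)).symm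
    rw [(indepFun_iff_map_prod_eq_prod_map_map (hpast n).aemeasurable hW.aemeasurable).1 h1,
      ← Measure.compProd_const]
    rfl
  -- Independence is the case of a kernel that sees nothing: the law of w given the noises is
  -- constant.
  have h2 := mutualInfo_message_prodMk_le μ (hpast n) hW _ measurable_const hindep
    (s := fun m g => firstShift (a ^ 2 * messagePoint M m) n + g)
    (fun m => measurable_id.const_add _) (fun m g => rfl)
  have hY : Measurable fun p : Fin M × Ω =>
      (firstShift (a ^ 2 * messagePoint M p.1) n + (fun j : Fin n => X j p.2),
        fun k => w k p.2) :=
    measurable_from_prod_countable_right fun m =>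
      ((hpast n).const_add (firstShift (a ^ 2 * messagePoint M m) n)).prodMk hW
  have h3 := mutualInfo_comp_le (Code.jointMeasure μ M) measurable_fst hY (measurable_eveMap a)
  have h4 := mutualInfo_firstShift_le hd hX (fun m : Fin M => a ^ 2 * messagePoint M m) hn
  have h5 := hbound M (fun m => firstShift (a ^ 2 * messagePoint M m) (d + 1)) fun m =>
    norm_firstShift_le (by
      rw [abs_mul, abs_of_nonneg (sq_nonneg a)]
      exact mul_le_mul_of_nonneg_left (abs_messagePoint_le hM m) (sq_nonneg a)) _
  refine le_trans (le_of_eq ?_) (h3.trans (h2.trans (h4.trans h5)))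
  rw [Code.leakage]
  congr 1
  funext p
  exact sk_code_eveObs ha hM _ _ _ _ _

theorem sk_secure (hch : IsAWGNWiretap μ σ w v vt vh) {a : ℝ} (ha : 1 < a) {R : ℝ} (hR : 0 ≤ R) :
    Secure μ w v vt vh ((skParams a).codeSeq R) := by
  refine ENNReal.tendsto_nhds_zero.2 fun δ hδ => ?_
  obtain ⟨η, hη, hηδ⟩ : ∃ η : ℝ, 0 < η ∧ ENNReal.ofReal η ≤ δ := by
    rcases eq_or_ne δ ⊤ with h | h
    · exact ⟨1, one_pos, h ▸ le_top⟩
    · exact ⟨δ.toReal, ENNReal.toReal_pos hδ.ne' h, ENNReal.ofReal_toReal_le⟩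
  have hlog : 0 < Real.log 2 := Real.log_pos one_lt_two
  -- As log₂ M ≤ n (1 + R) for n ≥ 1, this ε contributes at most η/2 per channel use; the other half
  -- is left for C/n.
  obtain ⟨C, hC, d, hCd⟩ := sk_leakage_le hch ha (ε := η / (2 * (1 + R))) (by positivity)
  have hlim := tendsto_const_div_atTop_nhds_zero_nat (C / Real.log 2)
  filter_upwards [eventually_gt_atTop d, eventually_gt_atTop 0,
    hlim.eventually_le_const (show (0 : ℝ) < η / 2 by positivity)] with n hn hn0 hCn
  have hn0' : (1 : ℝ) ≤ n := by exact_mod_cast hn0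
  have hM : (0 : ℝ) < numMessages R n := by exact_mod_cast numMessages_pos R n
  refine (ENNReal.div_le_div_right (hCd n hn _ (numMessages_pos R n)) _).trans (le_trans ?_ hηδ)
  rw [← ENNReal.ofReal_natCast n, ← ENNReal.ofReal_div_of_pos (by linarith)]
  refine ENNReal.ofReal_le_ofReal ?_
  have h1 : Real.log (numMessages R n) ≤ Real.log 2 * (n * (1 + R)) := by
    refine (Real.log_le_log hM (numMessages_le hR n)).trans ?_
    rw [Real.log_mul two_ne_zero (by positivity), Real.log_pow, Real.log_rpow two_pos]
    nlinarith
  calc (C + η / (2 * (1 + R)) * Real.log (numMessages R n)) / Real.log 2 / n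
    _ ≤ (C + η / (2 * (1 + R)) * (Real.log 2 * (n * (1 + R)))) / Real.log 2 / n := by gcongr
    _ = C / Real.log 2 / n + η / 2 := by
      have : (n : ℝ) ≠ 0 := by positivity
      field_simp
    _ ≤ η := by linarith

end

/-! ### Causality and measurability of codes -/

namespace Code

variable {n M : ℕ} {c : Code n M} (m : Fin M)

theorem output_congr {w w' : ℕ → ℝ} {i : ℕ} (h : ∀ j ≤ i, w j = w' j) :
    c.output m w i = c.output m w' i := by
  induction i using Nat.strong_induction_on with
  | _ i ih =>
    rw [Code.output, Code.output, h i le_rfl]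
    congr 2
    funext j
    congr 1
    funext l
    exact ih l (by omega) fun k hk => h k (by omega)

theorem input_congr {w w' : ℕ → ℝ} {i : ℕ} (h : ∀ j < i, w j = w' j) :
    c.input m w i = c.input m w' i := by
  rw [Code.input, Code.input]
  congr 1
  funext j
  rw [Code.feedback, Code.feedback]
  congr 1
  funext l
  exact output_congr m fun k hk => h k (by omega)

theorem IsMeasurable.input_of_output (hc : c.IsMeasurable) {i : ℕ}
    (h : ∀ j < i, Measurable fun w => c.output m w j) : Measurable fun w => c.input m w i := by
  refine (hc.1 i m).comp (measurable_pi_lambda _ fun j => (hc.2.1 j).comp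
    (measurable_pi_lambda _ fun l => h l (by omega)))

theorem IsMeasurable.output (hc : c.IsMeasurable) (i : ℕ) :
    Measurable fun w => c.output m w i := by
  induction i using Nat.strong_induction_on with
  | _ i ih =>
    simp only [output_eq]
    exact (hc.input_of_output m ih).add (measurable_pi_apply i)

theorem IsMeasurable.input (hc : c.IsMeasurable) (i : ℕ) : Measurable fun w => c.input m w i :=
  hc.input_of_output m fun j _ => hc.output m j

end Code

/-! ### Change of measure -/

/-- The logarithm of the ratio of the densities of `N(0, s)` at `x` and of `N(0, t)` at `y`. -/
noncomputable def gaussianLogRatio (s t : ℝ≥0) (x y : ℝ) : ℝ :=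
  1 / 2 * Real.log (t / s) - x ^ 2 / (2 * s) + y ^ 2 / (2 * t)

theorem measurable_gaussianLogRatio (s t : ℝ≥0) :
    Measurable fun p : ℝ × ℝ => gaussianLogRatio s t p.1 p.2 := by
  unfold gaussianLogRatio
  fun_prop

theorem gaussianPDF_mul_exp {s t : ℝ≥0} (hs : s ≠ 0) (ht : t ≠ 0) (x y : ℝ) :
    gaussianPDF 0 s x * ENNReal.ofReal (Real.exp (-gaussianLogRatio s t x y)) =
      gaussianPDF 0 t y := by
  have hs' : (0 : ℝ) < s := NNReal.coe_pos.2 (pos_iff_ne_zero.2 hs)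
  have ht' : (0 : ℝ) < t := NNReal.coe_pos.2 (pos_iff_ne_zero.2 ht)
  rw [gaussianPDF, gaussianPDF, ← ENNReal.ofReal_mul (gaussianPDFReal_nonneg _ _ _)]
  congr 1
  have h1 : Real.exp (-(1 / 2 * Real.log (t / s))) = (√(t / s))⁻¹ := by
    rw [Real.exp_neg, Real.sqrt_eq_rpow, Real.rpow_def_of_pos (by positivity), mul_comm]
  have h2 : -gaussianLogRatio s t x y =
      -(1 / 2 * Real.log (t / s)) + (x ^ 2 / (2 * s) + -y ^ 2 / (2 * t)) := by
    unfold gaussianLogRatio; ring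
  rw [h2, Real.exp_add, Real.exp_add, h1, gaussianPDFReal, gaussianPDFReal, sub_zero, sub_zero,
    neg_div, Real.exp_neg (x ^ 2 / (2 * s)), Real.sqrt_div ht'.le,
    Real.sqrt_mul (by positivity) (s : ℝ), Real.sqrt_mul (by positivity) (t : ℝ)]
  have := Real.exp_pos (x ^ 2 / (2 * s))
  have := Real.sqrt_pos.2 hs'
  have := Real.sqrt_pos.2 ht'
  field_simp

/-- Given the past the input is a constant u. By translation invariance of Lebesgue measure, the
weighted output has law N(0, t) whatever u is. -/
theorem lintegral_gaussian_shift {s t : ℝ≥0} (hs : s ≠ 0) (ht : t ≠ 0) (u : ℝ) {h : ℝ → ℝ≥0∞}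
    (hh : Measurable h) :
    ∫⁻ x, ENNReal.ofReal (Real.exp (-gaussianLogRatio s t x (u + x))) * h (u + x)
      ∂(gaussianReal 0 s) = ∫⁻ y, h y ∂(gaussianReal 0 t) := by
  have h1 : Measurable fun x =>
      ENNReal.ofReal (Real.exp (-gaussianLogRatio s t x (u + x))) := by
    unfold gaussianLogRatio
    fun_prop
  rw [gaussianReal_of_var_ne_zero _ hs, gaussianReal_of_var_ne_zero _ ht,
    lintegral_withDensity_eq_lintegral_mul _ (measurable_gaussianPDF _ _)
      (by exact h1.mul (hh.comp (measurable_id.const_add u))),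
    lintegral_withDensity_eq_lintegral_mul _ (measurable_gaussianPDF _ _) hh,
    ← lintegral_add_left_eq_self (μ := volume) (gaussianPDF 0 t * h) u]
  refine lintegral_congr fun x => ?_
  rw [Pi.mul_apply, Pi.mul_apply, ← mul_assoc, gaussianPDF_mul_exp hs ht]

theorem IsWhiteGaussian.indepFun_past {Ω : Type*} [MeasurableSpace Ω] {μ : Measure Ω} {σ : ℝ≥0}
    {w : ℕ → Ω → ℝ} (hw : IsWhiteGaussian μ σ w) (k : ℕ) :
    IndepFun (fun ω (j : Fin k) => w j ω) (w k) μ := by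
  have h1 := hw.white.indepFun_finset (Finset.range k) {k} (by simp) hw.measurable
  exact h1.comp (φ := fun (g : Finset.range k → ℝ) (j : Fin k) => g ⟨j, Finset.mem_range.2 j.2⟩)
    (ψ := fun (g : ({k} : Finset ℕ) → ℝ) => g ⟨k, Finset.mem_singleton_self k⟩)
    (measurable_pi_lambda _ fun j => measurable_pi_apply _) (measurable_pi_apply _)

/-- Appending an entry to a finite sequence. -/
def appendEntry {k : ℕ} (p : (Fin k → ℝ) × ℝ) (j : Fin (k + 1)) : ℝ :=
  if h : (j : ℕ) < k then p.1 ⟨j, h⟩ else p.2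

theorem measurable_appendEntry {k : ℕ} :
    Measurable (appendEntry : (Fin k → ℝ) × ℝ → Fin (k + 1) → ℝ) := by
  refine measurable_pi_lambda _ fun j => ?_
  unfold appendEntry
  split_ifs
  · exact (measurable_pi_apply _).comp measurable_fst
  · exact measurable_snd

theorem appendEntry_eq {k : ℕ} (f : ℕ → ℝ) :
    appendEntry (fun j : Fin k => f j, f k) = fun j : Fin (k + 1) => f j := by
  funext j
  by_cases h : (j : ℕ) < k
  · simp [appendEntry, h]
  · simp [appendEntry, show (j : ℕ) = k by omega]

section

variable {Ω : Type*} [MeasurableSpace Ω] {μ : Measure Ω} [IsProbabilityMeasure μ] {σ : ℝ≥0}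
  {w : ℕ → Ω → ℝ}

/-- The logarithm of the likelihood ratio of the first `k` outputs with respect to independent
centered Gaussian outputs of variance `t`. -/
noncomputable def Code.logRatio {n M : ℕ} (c : Code n M) (m : Fin M) (σ t : ℝ≥0) (k : ℕ)
    (w : ℕ → ℝ) : ℝ :=
  ∑ i ∈ Finset.range k, gaussianLogRatio (σ ^ 2) t (w i) (c.output m w i)

theorem Code.IsMeasurable.logRatio {n M : ℕ} {c : Code n M} (hc : c.IsMeasurable) (m : Fin M)
    (σ t : ℝ≥0) (k : ℕ) : Measurable (c.logRatio m σ t k) :=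
  Finset.measurable_sum _ fun i _ => (measurable_gaussianLogRatio _ _).comp
    ((measurable_pi_apply i).prodMk (hc.output m i))

/-- Under the measure with the reciprocal of the likelihood ratio as density, the law of the
outputs depends neither on the message nor on the code. -/
theorem exists_output_reference (hw : IsWhiteGaussian μ σ w) (hσ : σ ≠ 0) {t : ℝ≥0} (ht : t ≠ 0)
    (k : ℕ) :
    ∃ Q : Measure (Fin k → ℝ), IsProbabilityMeasure Q ∧
      ∀ {n M : ℕ} (c : Code n M), c.IsMeasurable → ∀ (m : Fin M) (h : (Fin k → ℝ) → ℝ≥0∞),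
        Measurable h →
          ∫⁻ ω, ENNReal.ofReal (Real.exp (-c.logRatio m σ t k (fun i => w i ω))) *
            h (fun j : Fin k => c.output m (fun i => w i ω) j) ∂μ = ∫⁻ y, h y ∂Q := by
  induction k with
  | zero =>
    refine ⟨Measure.dirac default, inferInstance, fun c hc m h hh => ?_⟩
    simp only [Code.logRatio, Finset.range_zero, Finset.sum_empty, neg_zero, Real.exp_zero,
      ENNReal.ofReal_one, one_mul]
    rw [lintegral_dirac' _ hh, ← mul_one (h default), ← measure_univ (μ := μ), ← lintegral_const]
    exact lintegral_congr fun ω => congrArg h (Subsingleton.elim _ _)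
  | succ k ih =>
    obtain ⟨Q, hQ, hQk⟩ := ih
    -- Each channel use appends an independent N(0, t) output. Integrating over the last noise first
    -- makes its input a constant, by causality and independence; the induction hypothesis treats
    -- the past.
    refine ⟨(Q.prod (gaussianReal 0 t)).map appendEntry,
      Measure.isProbabilityMeasure_map measurable_appendEntry.aemeasurable,
      fun c hc m h hh => ?_⟩
    have hs : σ ^ 2 ≠ 0 := pow_ne_zero 2 hσ
    have hext : Measurable (extendZero : (Fin k → ℝ) → ℕ → ℝ) :=
      measurable_pi_lambda _ (measurable_extendZero k)
    have hpast : Measurable fun ω (j : Fin k) => w j ω :=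
      measurable_pi_lambda _ fun j => hw.measurable j
    have hpw (ω : Ω) (j : ℕ) (hj : j < k) : w j ω = extendZero (fun j : Fin k => w j ω) j :=
      (extendZero_apply (n := k) (fun j => w j ω) hj).symm
    have hratio (ω : Ω) : c.logRatio m σ t k (fun i => w i ω) =
        c.logRatio m σ t k (extendZero fun j : Fin k => w j ω) := by
      refine Finset.sum_congr rfl fun i hi => ?_
      have hi' := Finset.mem_range.1 hi
      simp only
      rw [hpw ω i hi', Code.output_congr m fun j hj => hpw ω j (by omega)]
    have houtput (ω : Ω) : (fun j : Fin k => c.output m (fun i => w i ω) j) =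
        fun j : Fin k => c.output m (extendZero fun j : Fin k => w j ω) j := by
      funext j
      exact Code.output_congr m fun i hi => hpw ω i (by omega)
    have hinput (ω : Ω) : c.input m (fun i => w i ω) k =
        c.input m (extendZero fun j : Fin k => w j ω) k :=
      Code.input_congr m (hpw ω)
    set A : (Fin k → ℝ) → ℝ≥0∞ := fun p =>
      ENNReal.ofReal (Real.exp (-c.logRatio m σ t k (extendZero p))) with hA
    set Y : (Fin k → ℝ) → Fin k → ℝ := fun p j => c.output m (extendZero p) j with hY
    set U : (Fin k → ℝ) → ℝ := fun p => c.input m (extendZero p) k with hU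
    have hAm : Measurable A :=
      (Real.measurable_exp.comp ((hc.logRatio m σ t k).comp hext).neg).ennreal_ofReal
    have hYm : Measurable Y := measurable_pi_lambda _ fun j => (hc.output m j).comp hext
    have hUm : Measurable U := (hc.input m k).comp hext
    set F : (Fin k → ℝ) × ℝ → ℝ≥0∞ := fun p => A p.1 *
      (ENNReal.ofReal (Real.exp (-gaussianLogRatio (σ ^ 2) t p.2 (U p.1 + p.2))) *
        h (appendEntry (Y p.1, U p.1 + p.2))) with hF
    have hUx : Measurable fun p : (Fin k → ℝ) × ℝ => U p.1 + p.2 :=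
      (hUm.comp measurable_fst).add measurable_snd
    have hFm : Measurable F := by
      refine (hAm.comp measurable_fst).mul (Measurable.mul ?_ ?_)
      · exact (Real.measurable_exp.comp ((measurable_gaussianLogRatio _ _).comp
          (measurable_snd.prodMk hUx)).neg).ennreal_ofReal
      · exact hh.comp (measurable_appendEntry.comp ((hYm.comp measurable_fst).prodMk hUx))
    have happ (z : Fin k → ℝ) : Measurable fun y => h (appendEntry (z, y)) :=
      hh.comp (measurable_appendEntry.comp measurable_prodMk_left)
    have hAh : Measurable fun p => A p * ∫⁻ y, h (appendEntry (Y p, y)) ∂(gaussianReal 0 t) :=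
      hAm.mul ((hh.comp measurable_appendEntry).lintegral_prod_right'.comp hYm)
    calc ∫⁻ ω, ENNReal.ofReal (Real.exp (-c.logRatio m σ t (k + 1) (fun i => w i ω))) *
            h (fun j : Fin (k + 1) => c.output m (fun i => w i ω) j) ∂μ
      _ = ∫⁻ ω, F (fun j : Fin k => w j ω, w k ω) ∂μ := by
          refine lintegral_congr fun ω => ?_
          simp only [hF, hA, hY, hU]
          rw [← hratio, ← houtput, ← hinput, ← Code.output_eq,
            appendEntry_eq (c.output m fun i => w i ω), ← mul_assoc,
            ← ENNReal.ofReal_mul (Real.exp_pos _).le, ← Real.exp_add, ← neg_add, Code.logRatio,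
            Finset.sum_range_succ, Code.logRatio]
      _ = ∫⁻ p, F p ∂((μ.map fun ω (j : Fin k) => w j ω).prod (gaussianReal 0 (σ ^ 2))) := by
          rw [← hw.gaussian k, ← (indepFun_iff_map_prod_eq_prod_map_map hpast.aemeasurable
            (hw.measurable k).aemeasurable).1 (hw.indepFun_past k),
            lintegral_map hFm (hpast.prodMk (hw.measurable k))]
      _ = ∫⁻ p, A p * ∫⁻ y, h (appendEntry (Y p, y)) ∂(gaussianReal 0 t)
            ∂(μ.map fun ω (j : Fin k) => w j ω) := by
          rw [lintegral_prod _ hFm.aemeasurable]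
          refine lintegral_congr fun p => ?_
          simp only [hF]
          rw [lintegral_const_mul, lintegral_gaussian_shift hs ht (U p) (happ (Y p))]
          refine Measurable.mul ?_ ((happ (Y p)).comp (measurable_id.const_add (U p)))
          unfold gaussianLogRatio
          fun_prop
      _ = ∫⁻ ω, ENNReal.ofReal (Real.exp (-c.logRatio m σ t k (fun i => w i ω))) *
            ∫⁻ y, h (appendEntry (fun j : Fin k => c.output m (fun i => w i ω) j, y))
              ∂(gaussianReal 0 t) ∂μ := by
          rw [lintegral_map hAh hpast]
          refine lintegral_congr fun ω => ?_
          simp only [hA, hY]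
          rw [← hratio, ← houtput]
      _ = ∫⁻ z, ∫⁻ y, h (appendEntry (z, y)) ∂(gaussianReal 0 t) ∂Q :=
          hQk c hc m (fun z => ∫⁻ y, h (appendEntry (z, y)) ∂(gaussianReal 0 t))
            (hh.comp measurable_appendEntry).lintegral_prod_right'
      _ = ∫⁻ y, h y ∂((Q.prod (gaussianReal 0 t)).map appendEntry) := by
          rw [lintegral_map hh measurable_appendEntry,
            lintegral_prod _ (by exact (hh.comp measurable_appendEntry).aemeasurable)]

/-- Under the reference law each summand equals 1 + M Q(dec = m), and the decoding regions partition
the output space. -/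
theorem sum_lintegral_logRatio_le (hw : IsWhiteGaussian μ σ w) (hσ : σ ≠ 0) {t : ℝ≥0} (ht : t ≠ 0)
    {n M : ℕ} {c : Code n M} (hc : c.IsMeasurable) :
    ∑ m, ∫⁻ ω, ENNReal.ofReal (Real.exp (-c.logRatio m σ t n (fun i => w i ω))) *
      (1 + M * Set.indicator {ω | c.dec (fun j : Fin n => c.output m (fun i => w i ω) j) = m}
        1 ω) ∂μ = 2 * M := by
  obtain ⟨Q, hQ, hQn⟩ := exists_output_reference hw hσ ht n
  have hset (m : Fin M) : MeasurableSet {y | c.dec y = m} := hc.2.2 (measurableSet_singleton m)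
  have h1 (m : Fin M) : ∫⁻ ω, ENNReal.ofReal
      (Real.exp (-c.logRatio m σ t n (fun i => w i ω))) *
      (1 + M * Set.indicator {ω | c.dec (fun j : Fin n => c.output m (fun i => w i ω) j) = m}
        1 ω) ∂μ = 1 + M * Q {y | c.dec y = m} := by
    have hm : Measurable fun y => (M : ℝ≥0∞) * Set.indicator {y | c.dec y = m} 1 y :=
      (measurable_one.indicator (hset m)).const_mul _
    refine (hQn c hc m (fun y => 1 + M * Set.indicator {y | c.dec y = m} 1 y)
      (measurable_const.add hm)).trans ?_
    rw [lintegral_add_left measurable_const, lintegral_one, measure_univ,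
      lintegral_const_mul _ (measurable_one.indicator (hset m)), lintegral_indicator_one (hset m)]
  rw [Finset.sum_congr rfl fun m _ => h1 m, Finset.sum_add_distrib, ← Finset.mul_sum]
  have h2 : ∑ m, Q {y | c.dec y = m} = 1 := by
    have := sum_measure_preimage_singleton (μ := Q) (f := c.dec) Finset.univ
      fun m _ => hset m
    simp only [Finset.coe_univ, Set.preimage_univ, measure_univ] at this
    exact this
  rw [h2]
  simp [two_mul]

end

/-! ### The converse -/

section

variable {Ω : Type*} [MeasurableSpace Ω] {μ : Measure Ω} [IsProbabilityMeasure μ] {σ : ℝ≥0}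
  {w : ℕ → Ω → ℝ}

omit [IsProbabilityMeasure μ] in
-- The input is a function of strictly earlier noises, hence independent of the current centered
-- one.
theorem IsWhiteGaussian.integral_input_mul (hw : IsWhiteGaussian μ σ w) {n M : ℕ} {c : Code n M}
    (hc : c.IsMeasurable) (m : Fin M) (i : ℕ) :
    ∫ ω, c.input m (fun k => w k ω) i * w i ω ∂μ = 0 := by
  have hext : Measurable (extendZero : (Fin i → ℝ) → ℕ → ℝ) :=
    measurable_pi_lambda _ (measurable_extendZero i)
  have hW : Measurable fun ω k => w k ω := measurable_pi_lambda _ hw.measurable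
  have h1 : (fun ω => c.input m (fun k => w k ω) i) =
      (fun p : Fin i → ℝ => c.input m (extendZero p) i) ∘ fun ω (j : Fin i) => w j ω := by
    funext ω
    exact Code.input_congr m fun j hj => (extendZero_apply (n := i) (fun j => w j ω) hj).symm
  have h2 : IndepFun (fun ω => c.input m (fun k => w k ω) i) (w i) μ := by
    rw [h1]
    exact (hw.indepFun_past i).comp ((hc.input m i).comp hext) measurable_id
  rw [h2.integral_fun_mul_eq_mul_integral ((hc.input m i).comp hW).aestronglyMeasurable
    (hw.measurable i).aestronglyMeasurable, hw.integral_eq, mul_zero]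

theorem hasIntegral_gaussianLogRatio (hw : IsWhiteGaussian μ σ w) (hσ : σ ≠ 0) {t : ℝ≥0}
    {n M : ℕ} {c : Code n M} (hc : c.IsMeasurable) (m : Fin M) (i : ℕ)
    (hu : MemLp (fun ω => c.input m (fun k => w k ω) i) 2 μ) :
    Integrable (fun ω => gaussianLogRatio (σ ^ 2) t (w i ω) (c.output m (fun k => w k ω) i)) μ ∧
      ∫ ω, gaussianLogRatio (σ ^ 2) t (w i ω) (c.output m (fun k => w k ω) i) ∂μ =
        1 / 2 * Real.log (t / (σ : ℝ) ^ 2) - 1 / 2 +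
          (∫ ω, c.input m (fun k => w k ω) i ^ 2 ∂μ + (σ : ℝ) ^ 2) / (2 * t) := by
  have hσ' : (σ : ℝ) ≠ 0 := NNReal.coe_ne_zero.2 hσ
  have h1 := hu.integrable_sq
  have h2 := (hw.memLp i).integrable_sq
  have h3 : Integrable (fun ω => c.input m (fun k => w k ω) i * w i ω) μ :=
    hu.integrable_mul (hw.memLp i)
  have h4 : (fun ω => gaussianLogRatio (σ ^ 2) t (w i ω) (c.output m (fun k => w k ω) i)) =
      fun ω => 1 / 2 * Real.log (t / (σ : ℝ) ^ 2) +
        ((1 / (2 * t) - 1 / (2 * (σ : ℝ) ^ 2)) * w i ω ^ 2 +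
        (1 / (2 * t) * c.input m (fun k => w k ω) i ^ 2 +
        1 / t * (c.input m (fun k => w k ω) i * w i ω))) := by
    funext ω
    rw [gaussianLogRatio, Code.output_eq, NNReal.coe_pow]
    ring
  have h5 := (h1.const_mul (1 / (2 * (t : ℝ)))).add (h3.const_mul (1 / (t : ℝ)))
  have h6 := (h2.const_mul (1 / (2 * (t : ℝ)) - 1 / (2 * (σ : ℝ) ^ 2))).add h5
  rw [h4]
  refine ⟨(integrable_const _).add h6, ?_⟩
  rw [integral_add (integrable_const _) (by exact h6),
    integral_add (h2.const_mul _) (by exact h5), integral_add (h1.const_mul _) (h3.const_mul _),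
    integral_const]
  simp only [integral_const_mul, hw.integral_input_mul hc, hw.integral_sq, probReal_univ, one_smul]
  field_simp
  ring

/-- Integrates 1 + x ≤ exp x, with x = log M - I where decoding succeeds and x = -I elsewhere. The
factor 1 + M · 1_A dominates both cases, and no entropies are needed. -/
theorem mul_log_sub_integral_logRatio_le {t : ℝ≥0} (hw : IsWhiteGaussian μ σ w)
    {n M : ℕ} {c : Code n M} (hc : c.IsMeasurable) (hM : 0 < M) (m : Fin M)
    (hint : Integrable (fun ω => c.logRatio m σ t n fun k => w k ω) μ)
    (hfin : ∫⁻ ω, ENNReal.ofReal (Real.exp (-c.logRatio m σ t n (fun i => w i ω))) *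
      (1 + M * Set.indicator {ω | c.dec (fun j : Fin n => c.output m (fun i => w i ω) j) = m}
        1 ω) ∂μ ≠ ⊤) :
    μ.real {ω | c.dec (fun j : Fin n => c.output m (fun i => w i ω) j) = m} * Real.log M -
        ∫ ω, c.logRatio m σ t n (fun k => w k ω) ∂μ ≤
      (∫⁻ ω, ENNReal.ofReal (Real.exp (-c.logRatio m σ t n (fun i => w i ω))) *
        (1 + M * Set.indicator {ω | c.dec (fun j : Fin n => c.output m (fun i => w i ω) j) = m}
          1 ω) ∂μ).toReal - 1 := by
  have hM' : (0 : ℝ) < M := by exact_mod_cast hM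
  have hW : Measurable fun ω k => w k ω := measurable_pi_lambda _ hw.measurable
  set A := {ω | c.dec (fun j : Fin n => c.output m (fun i => w i ω) j) = m} with hA
  set I := fun ω => c.logRatio m σ t n fun k => w k ω with hI
  have hIm : Measurable I := (hc.logRatio m σ t n).comp hW
  have hAm : MeasurableSet A := (hc.2.2.comp (measurable_pi_lambda _ fun j : Fin n =>
    (hc.output m j).comp hW)) (measurableSet_singleton m)
  set H : Ω → ℝ := fun ω => Real.exp (-I ω) * (1 + M * A.indicator 1 ω) with hH
  have hH0 (ω : Ω) : 0 ≤ H ω := by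
    have : (0 : ℝ) ≤ A.indicator 1 ω := Set.indicator_nonneg (fun _ _ => zero_le_one) ω
    positivity
  have hHm : Measurable H := (Real.measurable_exp.comp hIm.neg).mul
    (measurable_const.add ((measurable_one.indicator hAm).const_mul _))
  have hHe : ∫⁻ ω, ENNReal.ofReal (Real.exp (-c.logRatio m σ t n (fun i => w i ω))) *
      (1 + M * A.indicator 1 ω) ∂μ = ∫⁻ ω, ENNReal.ofReal (H ω) ∂μ := by
    refine lintegral_congr fun ω => ?_
    simp only [hH]
    rw [ENNReal.ofReal_mul (Real.exp_pos _).le]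
    congr 1
    by_cases hω : ω ∈ A
    · simp only [Set.indicator_of_mem hω, Pi.one_apply, mul_one]
      rw [ENNReal.ofReal_add zero_le_one hM'.le]
      simp
    · simp [Set.indicator_of_notMem hω]
  rw [hHe] at hfin ⊢
  have hHint : Integrable H μ := (lintegral_ofReal_ne_top_iff_integrable
    hHm.aestronglyMeasurable (ae_of_all _ hH0)).1 hfin
  rw [← integral_eq_lintegral_of_nonneg_ae (ae_of_all _ hH0) hHm.aestronglyMeasurable]
  have hG : Integrable (A.indicator fun _ => Real.log M) μ :=
    (integrable_const _).indicator hAm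
  have hGI : ∫ ω, A.indicator (fun _ => Real.log M) ω ∂μ = μ.real A * Real.log M := by
    rw [integral_indicator_const _ hAm, smul_eq_mul]
  calc μ.real A * Real.log M - ∫ ω, I ω ∂μ
    _ = ∫ ω, A.indicator (fun _ => Real.log M) ω - I ω ∂μ := by rw [integral_sub hG hint, hGI]
    _ ≤ ∫ ω, H ω - 1 ∂μ := by
        refine integral_mono (hG.sub hint) (hHint.sub (integrable_const _)) fun ω => ?_
        simp only [hH]
        by_cases hω : ω ∈ A
        · simp only [Set.indicator_of_mem hω, Pi.one_apply, mul_one]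
          have h1 := Real.add_one_le_exp (Real.log M - I ω)
          rw [sub_eq_neg_add (Real.log M), Real.exp_add, Real.exp_log hM'] at h1
          nlinarith [Real.exp_pos (-I ω)]
        · simp only [Set.indicator_of_notMem hω, mul_zero, add_zero, mul_one]
          linarith [Real.add_one_le_exp (-I ω)]
    _ = ∫ ω, H ω ∂μ - 1 := by rw [integral_sub hHint (integrable_const _)]; simp

/-- Fano's inequality together with the bound on the information that the outputs give about the
message. -/
theorem one_sub_errorProb_mul_log_le (hw : IsWhiteGaussian μ σ w) (hσ : σ ≠ 0) {t : ℝ≥0}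
    (ht : t ≠ 0) {n M : ℕ} (hn : 0 < n) (hM : 0 < M) {c : Code n M} (hc : c.IsMeasurable)
    (hp : c.power μ w ≠ ⊤) :
    (1 - (c.errorProb μ w).toReal) * Real.log M ≤
      1 + n * (1 / 2 * Real.log (t / (σ : ℝ) ^ 2) - 1 / 2 +
        ((c.power μ w).toReal + (σ : ℝ) ^ 2) / (2 * t)) := by
  have hM' : (0 : ℝ) < M := by exact_mod_cast hM
  have hn' : (0 : ℝ) < n := by exact_mod_cast hn
  have hMe : (M : ℝ≥0∞) ≠ 0 := by exact_mod_cast hM.ne'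
  have hW : Measurable fun ω k => w k ω := measurable_pi_lambda _ hw.measurable
  have huW (m : Fin M) (i : ℕ) : Measurable fun ω => c.input m (fun k => w k ω) i :=
    (hc.input m i).comp hW
  have hpow : c.power μ w = (∑ i ∈ Finset.range n,
      (∑ m, ∫⁻ ω, ENNReal.ofReal (c.input m (fun k => w k ω) i ^ 2) ∂μ) / M) / n := by
    rw [Code.power]
    congr 1
    refine Finset.sum_congr rfl fun i _ => ?_
    rw [lintegral_jointMeasure]
    exact measurable_from_prod_countable_right fun m => ((huW m i).pow_const 2).ennreal_ofReal
  -- A finite average over finitely many messages and times forces every input within the block to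
  -- have finite second moment.
  have hfin (i : ℕ) (hi : i ∈ Finset.range n) (m : Fin M) :
      ∫⁻ ω, ENNReal.ofReal (c.input m (fun k => w k ω) i ^ 2) ∂μ ≠ ⊤ := by
    intro h
    refine hp ?_
    rw [hpow, ENNReal.sum_eq_top.2 ⟨i, hi, ?_⟩, ENNReal.top_div_of_ne_top (by simp)]
    rw [ENNReal.sum_eq_top.2 ⟨m, Finset.mem_univ m, h⟩, ENNReal.top_div_of_ne_top (by simp)]
  have hmem (i : ℕ) (hi : i ∈ Finset.range n) (m : Fin M) :
      MemLp (fun ω => c.input m (fun k => w k ω) i) 2 μ := by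
    rw [memLp_two_iff_integrable_sq (huW m i).aestronglyMeasurable]
    exact (lintegral_ofReal_ne_top_iff_integrable ((huW m i).pow_const 2).aestronglyMeasurable
      (ae_of_all _ fun ω => sq_nonneg _)).1 (hfin i hi m)
  set e : Fin M → ℕ → ℝ := fun m i => ∫ ω, c.input m (fun k => w k ω) i ^ 2 ∂μ with he
  have hpowR : (c.power μ w).toReal * (n * M) = ∑ m, ∑ i ∈ Finset.range n, e m i := by
    have h1 (i : ℕ) (hi : i ∈ Finset.range n) :
        (∑ m, ∫⁻ ω, ENNReal.ofReal (c.input m (fun k => w k ω) i ^ 2) ∂μ) / M ≠ ⊤ :=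
      ENNReal.div_ne_top (ENNReal.sum_ne_top.2 fun m _ => hfin i hi m) hMe
    rw [hpow, ENNReal.toReal_div, ENNReal.toReal_sum h1, Finset.sum_comm]
    have h2 (i : ℕ) (hi : i ∈ Finset.range n) :
        ((∑ m, ∫⁻ ω, ENNReal.ofReal (c.input m (fun k => w k ω) i ^ 2) ∂μ) / M).toReal =
          (∑ m, e m i) / M := by
      rw [ENNReal.toReal_div, ENNReal.toReal_sum fun m _ => hfin i hi m]
      congr 1
      refine Finset.sum_congr rfl fun m _ => ?_
      rw [he]
      exact (integral_eq_lintegral_of_nonneg_ae (ae_of_all _ fun ω => sq_nonneg _)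
        ((huW m i).pow_const 2).aestronglyMeasurable).symm
    rw [Finset.sum_congr rfl h2, ← Finset.sum_div, ENNReal.toReal_natCast]
    field_simp
  have hint (m : Fin M) : Integrable (fun ω => c.logRatio m σ t n fun k => w k ω) μ :=
    integrable_finsetSum _ fun i hi => (hasIntegral_gaussianLogRatio hw hσ hc m i (hmem i hi m)).1
  have hval (m : Fin M) : ∫ ω, c.logRatio m σ t n (fun k => w k ω) ∂μ =
      n * (1 / 2 * Real.log (t / (σ : ℝ) ^ 2) - 1 / 2 + (σ : ℝ) ^ 2 / (2 * t)) +
        (∑ i ∈ Finset.range n, e m i) / (2 * t) := by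
    simp only [Code.logRatio]
    rw [integral_finsetSum _ fun i hi =>
      (hasIntegral_gaussianLogRatio hw hσ hc m i (hmem i hi m)).1,
      Finset.sum_congr rfl fun i hi => (hasIntegral_gaussianLogRatio hw hσ hc m i (hmem i hi m)).2,
      Finset.sum_div]
    simp only [add_div, Finset.sum_add_distrib, Finset.sum_const, Finset.card_range, nsmul_eq_mul]
    ring
  set B : Fin M → Set Ω := fun m =>
    {ω | c.dec (fun j : Fin n => c.output m (fun i => w i ω) j) = m} with hB
  have hBm (m : Fin M) : MeasurableSet (B m) := (hc.2.2.comp (measurable_pi_lambda _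
    fun j : Fin n => (hc.output m j).comp hW)) (measurableSet_singleton m)
  have herr : (c.errorProb μ w).toReal * M = M - ∑ m, μ.real (B m) := by
    have h1 (m : Fin M) : {ω | c.dec (fun j : Fin n => c.output m (fun i => w i ω) j) ≠ m} =
        (B m)ᶜ := rfl
    rw [Code.errorProb, ENNReal.toReal_div, ENNReal.toReal_sum fun m _ => measure_ne_top _ _,
      ENNReal.toReal_natCast, div_mul_cancel₀ _ hM'.ne']
    simp only [h1]
    have h2 (m : Fin M) : (μ (B m)ᶜ).toReal = 1 - μ.real (B m) := by
      rw [← measureReal_def, probReal_compl_eq_one_sub (hBm m)]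
    simp [h2]
  have hsum := sum_lintegral_logRatio_le hw hσ ht hc
  have hne (m : Fin M) := (ENNReal.lt_top_of_sum_ne_top
    (by rw [hsum]; exact ENNReal.mul_ne_top (by simp) (by simp)) (Finset.mem_univ m)).ne
  have hsumR := congrArg ENNReal.toReal hsum
  rw [ENNReal.toReal_sum fun m _ => hne m] at hsumR
  -- Summed over the messages, the right side is 2M - M = M, which becomes the additive constant 1
  -- after division by M.
  have hkey := Finset.sum_le_sum fun m (_ : m ∈ Finset.univ) =>
    mul_log_sub_integral_logRatio_le hw hc hM m (hint m) (hne m)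
  rw [Finset.sum_sub_distrib, Finset.sum_sub_distrib, hsumR, ← Finset.sum_mul,
    Finset.sum_congr rfl fun m _ => hval m, Finset.sum_add_distrib, ← Finset.sum_div,
    ← hpowR] at hkey
  simp only [Finset.sum_const, Finset.card_univ, Fintype.card_fin, nsmul_eq_mul, mul_one,
    ENNReal.toReal_mul, ENNReal.toReal_natCast, ENNReal.toReal_ofNat] at hkey
  refine le_of_mul_le_mul_left ?_ hM'
  have h3 : (M : ℝ) * ((1 - (c.errorProb μ w).toReal) * Real.log M) =
      (∑ m, μ.real (B m)) * Real.log M := by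
    linear_combination (-Real.log M) * herr
  rw [h3]
  calc (∑ m, μ.real (B m)) * Real.log M
    _ ≤ M + (M * (n * (1 / 2 * Real.log (t / (σ : ℝ) ^ 2) - 1 / 2 + (σ : ℝ) ^ 2 / (2 * t))) +
        (c.power μ w).toReal * (n * M) / (2 * t)) := by linarith
    _ = _ := by ring

theorem rate_le_of_reliable (hw : IsWhiteGaussian μ σ w) (hσ : 0 < σ) {P : ℝ} (hP : 0 < P) {R : ℝ}
    (hR : 0 ≤ R) {c : CodeSeq R} (hc : Reliable μ w c) (hpow : LongRunPower μ w P c) :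
    R ≤ 1 / 2 * Real.logb 2 (1 + P / (σ : ℝ) ^ 2) := by
  have hlog : 0 < Real.log 2 := Real.log_pos one_lt_two
  have hσ' : (0 : ℝ) < σ := hσ
  -- The output variance at full power; with this choice -1/2 + (p + σ²)/(2t) vanishes at p = P.
  set t : ℝ≥0 := ⟨P + (σ : ℝ) ^ 2, by positivity⟩ with ht
  have ht' : (t : ℝ) = P + (σ : ℝ) ^ 2 := rfl
  have ht0 : (0 : ℝ) < t := by rw [ht']; positivity
  have ht0' : t ≠ 0 := (NNReal.coe_pos.1 ht0).ne'
  have hcap : 1 / 2 * Real.log (t / (σ : ℝ) ^ 2) =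
      1 / 2 * Real.logb 2 (1 + P / (σ : ℝ) ^ 2) * Real.log 2 := by
    rw [ht', mul_assoc, Real.logb, div_mul_cancel₀ _ hlog.ne']
    congr 2
    field_simp
    ring
  -- A single block length suffices, at which the excess power, the error probability and 1/n are
  -- all at most δ; afterwards δ tends to 0.
  have key (δ : ℝ) (hδ : 0 < δ) (hδ1 : δ < 1) :
      (1 - δ) * (R * Real.log 2) ≤ δ + (1 / 2 * Real.log (t / (σ : ℝ) ^ 2) + δ / (2 * t)) := by
    have h1 : ∀ᶠ n in atTop, (c n).power μ w < ENNReal.ofReal (P + δ) :=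
      eventually_lt_of_limsup_lt (lt_of_le_of_lt hpow
        ((ENNReal.ofReal_lt_ofReal_iff (by positivity)).2 (by linarith)))
    have h2 : ∀ᶠ n in atTop, (c n).errorProb μ w ≤ ENNReal.ofReal δ :=
      ENNReal.tendsto_nhds_zero.1 hc.2 _ (ENNReal.ofReal_pos.2 hδ)
    have h3 := (tendsto_const_div_atTop_nhds_zero_nat 1).eventually_le_const hδ
    obtain ⟨n, h1, h2, h3, hn⟩ := (h1.and (h2.and (h3.and (eventually_gt_atTop 0)))).exists
    have hn' : (0 : ℝ) < n := by exact_mod_cast hn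
    have h4 := one_sub_errorProb_mul_log_le hw hσ.ne' ht0' hn (numMessages_pos R n) (hc.1 n)
      h1.ne_top
    have h5 : ((c n).power μ w).toReal ≤ P + δ := by
      rw [← ENNReal.toReal_ofReal (show 0 ≤ P + δ by positivity)]
      exact ENNReal.toReal_mono ENNReal.ofReal_ne_top h1.le
    have h6 : ((c n).errorProb μ w).toReal ≤ δ := by
      rw [← ENNReal.toReal_ofReal hδ.le]
      exact ENNReal.toReal_mono ENNReal.ofReal_ne_top h2
    have h7 : n * (R * Real.log 2) ≤ Real.log (numMessages R n) := by
      rw [← mul_assoc, ← Real.log_rpow two_pos]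
      exact Real.log_le_log (by positivity) (Nat.le_ceil _)
    have h8 : (1 - δ) * (n * (R * Real.log 2)) ≤
        1 + n * (1 / 2 * Real.log (t / (σ : ℝ) ^ 2) - 1 / 2 + (P + δ + (σ : ℝ) ^ 2) / (2 * t)) :=
      calc (1 - δ) * (n * (R * Real.log 2))
        _ ≤ (1 - ((c n).errorProb μ w).toReal) * Real.log (numMessages R n) := by
          have : 0 ≤ n * (R * Real.log 2) := by positivity
          gcongr
          linarith
        _ ≤ _ := h4
        _ ≤ _ := by gcongr
    have h9 : (P + δ + (σ : ℝ) ^ 2) / (2 * t) = 1 / 2 + δ / (2 * t) := by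
      rw [show P + δ + (σ : ℝ) ^ 2 = t + δ by rw [ht']; ring]
      field_simp
    rw [h9] at h8
    have h10 : 1 ≤ n * δ := by rwa [div_le_iff₀ hn', mul_comm] at h3
    refine le_of_mul_le_mul_left ?_ hn'
    linarith
  have hl : Tendsto (fun δ : ℝ => (1 - δ) * (R * Real.log 2)) (𝓝[>] 0)
      (𝓝 ((1 - 0) * (R * Real.log 2))) :=
    (Continuous.tendsto (by fun_prop) 0).mono_left nhdsWithin_le_nhds
  have hr : Tendsto (fun δ : ℝ => δ + (1 / 2 * Real.log (t / (σ : ℝ) ^ 2) + δ / (2 * t))) (𝓝[>] 0)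
      (𝓝 (0 + (1 / 2 * Real.log (t / (σ : ℝ) ^ 2) + 0 / (2 * t)))) :=
    (Continuous.tendsto (by fun_prop) 0).mono_left nhdsWithin_le_nhds
  have hle := le_of_tendsto_of_tendsto hl hr (by
    filter_upwards [Ioo_mem_nhdsGT (show (0 : ℝ) < 1 from one_pos)] with δ hδ
    exact key δ hδ.1 hδ.2)
  rw [hcap, sub_zero, one_mul, zero_add, zero_div, add_zero] at hle
  exact le_of_mul_le_mul_right hle hlog

end

/-! ### Capacities -/

/-- The code that always sends zero. -/
def zeroCode (n : ℕ) {M : ℕ} (hM : 0 < M) : Code n M where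
  enc _ _ _ := 0
  fb _ _ := 0
  dec _ := ⟨0, hM⟩

theorem zeroCode_isMeasurable (n : ℕ) {M : ℕ} (hM : 0 < M) : (zeroCode n hM).IsMeasurable :=
  ⟨fun _ _ => measurable_const, fun _ => measurable_const, measurable_const⟩

/-- The amplification `A_u` of the scheme for the transmit power `P`. -/
noncomputable def gain (P : ℝ) (σ : ℝ≥0) : ℝ := √((P + (σ : ℝ) ^ 2) / (σ : ℝ) ^ 2)

theorem gain_sq {P : ℝ} (hP : 0 < P) {σ : ℝ≥0} (hσ : 0 < σ) :
    gain P σ ^ 2 = 1 + P / (σ : ℝ) ^ 2 := by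
  have hσ' : (0 : ℝ) < σ := hσ
  rw [gain, Real.sq_sqrt (by positivity)]
  field_simp
  ring

theorem one_lt_gain {P : ℝ} (hP : 0 < P) {σ : ℝ≥0} (hσ : 0 < σ) : 1 < gain P σ := by
  have hσ' : (0 : ℝ) < σ := hσ
  have h0 : 0 ≤ gain P σ := Real.sqrt_nonneg _
  have h1 : 0 < P / (σ : ℝ) ^ 2 := by positivity
  nlinarith [gain_sq hP hσ]

theorem gain_sq_sub_one_mul {P : ℝ} (hP : 0 < P) {σ : ℝ≥0} (hσ : 0 < σ) :
    (gain P σ ^ 2 - 1) * (σ : ℝ) ^ 2 = P := by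
  have hσ' : (0 : ℝ) < σ := hσ
  rw [gain_sq hP hσ]
  field_simp
  ring

/-- The capacity of the additive white Gaussian noise channel, in bits per channel use. -/
noncomputable def capacity (P : ℝ) (σ : ℝ≥0) : ℝ := 1 / 2 * Real.logb 2 (1 + P / (σ : ℝ) ^ 2)

theorem lt_capacity_iff {P : ℝ} (hP : 0 < P) {σ : ℝ≥0} (hσ : 0 < σ) {R : ℝ} :
    R < capacity P σ ↔ (2 : ℝ) ^ R < gain P σ := by
  have h0 : 0 < gain P σ := one_pos.trans (one_lt_gain hP hσ)
  have h1 : capacity P σ = Real.logb 2 (gain P σ) := by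
    rw [capacity, ← gain_sq hP hσ, ← Real.rpow_natCast, Real.logb_rpow_eq_mul_logb_of_pos h0]
    push_cast
    ring
  rw [h1, Real.lt_logb_iff_rpow_lt one_lt_two h0]

theorem capacity_pos {P : ℝ} (hP : 0 < P) {σ : ℝ≥0} (hσ : 0 < σ) : 0 < capacity P σ :=
  (lt_capacity_iff hP hσ).2 (by simpa using one_lt_gain hP hσ)

/-- Leaves a margin P - P' that can absorb the energy of the first input under the block constraint.
-/
theorem exists_lt_capacity {P : ℝ} (hP : 0 < P) {σ : ℝ≥0} (hσ : 0 < σ) {R : ℝ} (hR0 : 0 ≤ R)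
    (hR : R < capacity P σ) : ∃ P', 0 < P' ∧ P' < P ∧ R < capacity P' σ := by
  have hσ' : (0 : ℝ) < σ := hσ
  have h1 : 1 ≤ (2 : ℝ) ^ R := Real.one_le_rpow one_le_two hR0
  have hg := one_lt_gain hP hσ
  have h2 : (((2 : ℝ) ^ R) ^ 2 - 1) * (σ : ℝ) ^ 2 < P := by
    rw [← gain_sq_sub_one_mul hP hσ]
    have := (lt_capacity_iff hP hσ).1 hR
    gcongr
  obtain ⟨P', h3, h4⟩ := exists_between h2
  have h5 : 0 < P' := lt_of_le_of_lt (mul_nonneg (by nlinarith) (by positivity)) h3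
  refine ⟨P', h5, h4, (lt_capacity_iff h5 hσ).2 ?_⟩
  rw [← gain_sq_sub_one_mul h5 hσ] at h3
  have h6 := lt_of_mul_lt_mul_right h3 (by positivity)
  exact lt_of_pow_lt_pow_left₀ 2 (zero_le_one.trans (one_lt_gain h5 hσ).le) (by linarith)

section

variable {Ω : Type*} [MeasurableSpace Ω] {μ : Measure Ω} [IsProbabilityMeasure μ] {σ : ℝ≥0}
  {w v vt vh : ℕ → Ω → ℝ}

theorem exists_blockPower_secure (hch : IsAWGNWiretap μ σ w v vt vh) (hσ : 0 < σ) {P R : ℝ}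
    (hP : 0 < P) (hR0 : 0 ≤ R) (hR : R < capacity P σ) :
    ∃ c : CodeSeq R, Reliable μ w c ∧ BlockPower μ w P c ∧ Secure μ w v vt vh c := by
  obtain ⟨P', hP', hPP, hR'⟩ := exists_lt_capacity hP hσ hR0 hR
  have ha := one_lt_gain hP' hσ
  set a := gain P' σ with haP
  have hw := hch.isWhiteGaussian
  have hrel := sk_reliable hw hR0 ha ((lt_capacity_iff hP' hσ).1 hR')
  have hsec := sk_secure hch ha hR0
  obtain ⟨N, hN⟩ := eventually_atTop.1 ((tendsto_const_div_atTop_nhds_zero_nat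
    (a ^ 4 / 4)).eventually_le_const (sub_pos.2 hPP))
  -- From N on the excess a⁴/(4n) fits into P - P'; the `1` supplies the positive block length that
  -- the power bound requires. The short blocks send zero, which affects no limit.
  set c : CodeSeq R := fun n => if max N 1 ≤ n then (skParams a).codeSeq R n else
    zeroCode n (numMessages_pos R n) with hc
  have hev : ∀ᶠ n in atTop, (skParams a).codeSeq R n = c n := by
    filter_upwards [eventually_ge_atTop (max N 1)] with n hn
    rw [hc]
    simp only [if_pos hn]
  refine ⟨c, ⟨fun n => ?_, hrel.2.congr' ?_⟩, fun n => ?_, Tendsto.congr' ?_ hsec⟩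
  · simp only [hc]
    split_ifs
    · exact hrel.1 n
    · exact zeroCode_isMeasurable _ _
  · filter_upwards [hev] with n hn
    rw [hn]
  · simp only [hc]
    split_ifs with hn
    · refine (sk_code_power_le hw a ha (le_of_max_le_right hn) (numMessages_pos R n)).trans
        (ENNReal.ofReal_le_ofReal ?_)
      have h1 := hN n (le_of_max_le_left hn)
      rw [gain_sq_sub_one_mul hP' hσ]
      linarith
    · simp [Code.power, Code.input, zeroCode]
  · filter_upwards [hev] with n hn
    rw [hn]

omit [IsProbabilityMeasure μ] in
theorem BlockPower.longRunPower {P R : ℝ} {c : CodeSeq R} (h : BlockPower μ w P c) :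
    LongRunPower μ w P c :=
  limsup_le_of_le (h := Eventually.of_forall h)

theorem isLUB_of_forall_lt {S : Set ℝ} {C : ℝ} (hC : 0 < C) (hle : ∀ R ∈ S, R ≤ C)
    (hmem : ∀ R, 0 ≤ R → R < C → R ∈ S) : IsLUB S C := by
  refine ⟨hle, fun b hb => le_of_forall_lt_imp_le_of_dense fun R hR => ?_⟩
  -- Only nonnegative rates are known to lie in S, so R is raised to `max R 0`, still below C
  -- because C > 0.
  exact (le_max_left R 0).trans (hb (hmem _ (le_max_right R 0) (max_lt hR hC)))

end

end FeedbackWiretap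

/-! ### The main theorem -/

theorem mainTheorem3 {Ω : Type*} [MeasurableSpace Ω] (μ : Measure Ω) [IsProbabilityMeasure μ]
    (P : ℝ) (hP : 0 < P) (σ : ℝ≥0) (hσ : 0 < σ) (w v vt vh : ℕ → Ω → ℝ)
    (hch : FeedbackWiretap.IsAWGNWiretap μ σ w v vt vh)
    (Au Bu Cu C : ℝ) (hAu : Au = √((P + (σ : ℝ) ^ 2) / (σ : ℝ) ^ 2))
    (hBu : Bu = -(√(Au ^ 2 - 1) / Au)) (hCu : Cu = -√(Au ^ 2 - 1))
    (hC : C = 1 / 2 * Real.logb 2 (1 + P / (σ : ℝ) ^ 2)) :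
    -- the scheme is the original one, up to scaling of the message point by `Au`
    (∀ (x : ℝ) (y : ℕ → ℝ) (i : ℕ),
      (FeedbackWiretap.KParams.scalar 0 0 0 Au Bu Cu).input (fun _ => x) y i =
          FeedbackWiretap.skInput Au (Au * x) y i ∧
        Au * (FeedbackWiretap.KParams.scalar 0 0 0 Au Bu Cu).estimate y (i + 1) 0 =
          FeedbackWiretap.skEstimate Au y i) ∧
    -- it achieves with secrecy all the rates below `C`
    (∀ R : ℝ, 0 ≤ R → R < C →
      FeedbackWiretap.Reliable μ w
          ((FeedbackWiretap.KParams.scalar 0 0 0 Au Bu Cu).codeSeq R) ∧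
        FeedbackWiretap.LongRunPower μ w P
          ((FeedbackWiretap.KParams.scalar 0 0 0 Au Bu Cu).codeSeq R) ∧
        FeedbackWiretap.Secure μ w v vt vh
          ((FeedbackWiretap.KParams.scalar 0 0 0 Au Bu Cu).codeSeq R)) ∧
    -- `C` is the secrecy capacity and the feedback capacity
    IsLUB (FeedbackWiretap.secrecyRates μ w v vt vh (FeedbackWiretap.LongRunPower μ w P)) C ∧
    IsLUB (FeedbackWiretap.feedbackRates μ w (FeedbackWiretap.LongRunPower μ w P)) C ∧
    IsLUB (FeedbackWiretap.secrecyRates μ w v vt vh (FeedbackWiretap.BlockPower μ w P)) C ∧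
    IsLUB (FeedbackWiretap.feedbackRates μ w (FeedbackWiretap.BlockPower μ w P)) C := by
  have hbelow : ∀ R : ℝ, 0 ≤ R → R < C →
      FeedbackWiretap.Reliable μ w
          ((FeedbackWiretap.KParams.scalar 0 0 0 Au Bu Cu).codeSeq R) ∧
        FeedbackWiretap.LongRunPower μ w P
          ((FeedbackWiretap.KParams.scalar 0 0 0 Au Bu Cu).codeSeq R) ∧
        FeedbackWiretap.Secure μ w v vt vh
          ((FeedbackWiretap.KParams.scalar 0 0 0 Au Bu Cu).codeSeq R) := by
    subst hBu hCu hAu hC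
    intro R hR0 hR
    have ha := FeedbackWiretap.one_lt_gain hP hσ
    refine ⟨FeedbackWiretap.sk_reliable hch.isWhiteGaussian hR0 ha
      ((FeedbackWiretap.lt_capacity_iff hP hσ).1 hR), ?_,
      FeedbackWiretap.sk_secure hch ha hR0⟩
    have h := FeedbackWiretap.sk_longRunPower hch.isWhiteGaussian R ha
    rwa [FeedbackWiretap.gain_sq_sub_one_mul hP hσ] at h
  have hAu1 : 1 < Au := hAu ▸ FeedbackWiretap.one_lt_gain hP hσ
  have hCpos : 0 < C := hC ▸ FeedbackWiretap.capacity_pos hP hσ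
  have hconv : ∀ {R : ℝ}, 0 ≤ R → ∀ {c : FeedbackWiretap.CodeSeq R},
      FeedbackWiretap.Reliable μ w c → FeedbackWiretap.LongRunPower μ w P c → R ≤ C :=
    fun hR0 _ hrel hpow => hC ▸
      FeedbackWiretap.rate_le_of_reliable hch.isWhiteGaussian hσ hP hR0 hrel hpow
  have hblock : ∀ R : ℝ, 0 ≤ R → R < C → ∃ c : FeedbackWiretap.CodeSeq R,
      FeedbackWiretap.Reliable μ w c ∧ FeedbackWiretap.BlockPower μ w P c ∧
        FeedbackWiretap.Secure μ w v vt vh c := by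
    subst hC
    exact fun R hR0 hR => FeedbackWiretap.exists_blockPower_secure hch hσ hP hR0 hR
  refine ⟨fun x y i => ?_, hbelow, ?_, ?_, ?_, ?_⟩
  · subst hBu hCu
    exact ⟨FeedbackWiretap.scalar_input_eq_skInput (by positivity) x y i,
      FeedbackWiretap.scalar_estimate_eq_skEstimate (by positivity) _ y i⟩
  · refine FeedbackWiretap.isLUB_of_forall_lt hCpos
      (fun R ⟨hR0, c, hrel, hpow, _⟩ => hconv hR0 hrel hpow) fun R hR0 hR => ?_
    exact ⟨hR0, _, (hbelow R hR0 hR).1, (hbelow R hR0 hR).2.1, (hbelow R hR0 hR).2.2⟩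
  · refine FeedbackWiretap.isLUB_of_forall_lt hCpos
      (fun R ⟨hR0, c, hrel, hpow⟩ => hconv hR0 hrel hpow) fun R hR0 hR => ?_
    exact ⟨hR0, _, (hbelow R hR0 hR).1, (hbelow R hR0 hR).2.1⟩
  · refine FeedbackWiretap.isLUB_of_forall_lt hCpos
      (fun R ⟨hR0, c, hrel, hpow, _⟩ => hconv hR0 hrel hpow.longRunPower) fun R hR0 hR => ?_
    obtain ⟨c, hrel, hpow, hsec⟩ := hblock R hR0 hR
    exact ⟨hR0, c, hrel, hpow, hsec⟩
  · refine FeedbackWiretap.isLUB_of_forall_lt hCpos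
      (fun R ⟨hR0, c, hrel, hpow⟩ => hconv hR0 hrel hpow.longRunPower) fun R hR0 hR => ?_
    obtain ⟨c, hrel, hpow, _⟩ := hblock R hR0 hR
    exact ⟨hR0, c, hrel, hpow⟩
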